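/- **Setting.** Let $r\ge 1$ and let $\mathcal X_1,\dots,\mathcal X_r,\mathcal Y_1,\dots,\mathcal Y_r$ be nonzero finite-dimensional complex Euclidean spaces with fixed standard bases; put $\mathcal X_{r+1}=\mathbb C$, and write $\mathcal X_{1..r}=\mathcal X_1\otimes\cdots\otimes\mathcal X_r$, $\mathcal Y_{1..r}=\mathcal Y_1\otimes\cdots\otimes\mathcal Y_r$. An $r$-round *pure strategy* $\tilde A$ consists of finite-dimensional memory spaces $\mathcal Z_0=\mathbb C,\mathcal Z_1,\dots,\mathcal Z_r$ and linear isometries $A_i:\mathcal X_i\otimes\mathcal Z_{i-1}\to\mathcal Y_i\otimes\mathcal Z_i$ ($1\le i\le r$). An $r$-round *pure co-strategy* $\tilde B$ consists of finite-dimensional memory spaces $\mathcal W_0,\dots,\mathcal W_r$, a unit vector $|\beta\rangle\in\mathcal X_1\otimes\mathcal W_0$ and linear isometries $B_i:\mathcal Y_i\otimes\mathcal W_{i-1}\to\mathcal X_{i+1}\otimes\mathcal W_i$. Composing the $A_i$ (tensored with identities) gives an isometry $\tilde A:\mathcal X_{1..r}\to\mathcal Y_{1..r}\otimes\mathcal Z_r$;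 composing $|\beta\rangle$ and the $B_i$ gives an isometry $\tilde B:\mathcal Y_{1..r}\to\mathcal X_{1..r}\otimes\mathcal W_r$. For a linear map $\Phi$ let $J(\Phi)=\sum_{i,j}\Phi(|i\rangle\langle j|)\otimes|i\rangle\langle j|$. A *strategy* is an operator on $\mathcal Y_{1..r}\otimes\mathcal X_{1..r}$ of the form $J(\Phi)$ with $\Phi(M)=\mathrm{Tr}_{\mathcal Z_r}(\tilde AM\tilde A^*)$ for some pure strategy $\tilde A$, called a *purification* of it; a *co-strategy* is an operator $J(\Psi^*)$, where $\Psi^*$ is the adjoint of $\Psi(N)=\mathrm{Tr}_{\mathcal W_r}(\tilde BN\tilde B^*)$ for some pure co-strategy $\tilde B$. The *final state* is $|\psi(\tilde A,\tilde B)\rangle=(I\otimes B_r)(A_r\otimes I)\cdots(I\otimes B_1)(A_1\otimes I)|\beta\rangle\in\mathcal Z_r\otimes\mathcal W_r$. For a strategy $S$ with purification $\tilde S$ put $\rho_S(\tilde B)=\mathrm{Tr}_{\mathcal Z_r}|\psi(\tilde S,\tilde B)\rangle\langle\psi(\tilde S,\tilde B)|$, which does not depend on the choice of $\tilde S$. With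 $\|M\|_1=\mathrm{Tr}\sqrt{M^*M}$ and $F(P,Q)=\|\sqrt P\sqrt Q\|_1$, the *strategy fidelity* of strategies $S,T$ is $$F_r(S,T)=\min_{\tilde B}F(\rho_S(\tilde B),\rho_T(\tilde B)),$$ the minimum being over all pure co-strategies. The *strategy norm* of a Hermitian operator $H$ on $\mathcal Y_{1..r}\otimes\mathcal X_{1..r}$ is $$\|H\|_r=\max\{\langle B_0-B_1,H\rangle : B_0,B_1\succeq 0,\ B_0+B_1\text{ is a co-strategy}\}.$$ Strategies $S,T$ are *perfectly distinguishable* if there are a pure co-strategy $\tilde B$ and positive semidefinite $P_0,P_1$ on its final memory space $\mathcal W_r$ with $P_0+P_1=I$, $\mathrm{Tr}(P_0\rho_S(\tilde B))=1$ and $\mathrm{Tr}(P_1\rho_T(\tilde B))=1$. **Proposition (Basic properties).** For all $r$-round strategies $S,T$ with the above input and output spaces, the minimum defining $F_r(S,T)$ and the maximum defining $\|S-T\|_r$ are attained, and: 1. (Fuchs–van de Graaf inequalities) $1-\tfrac12\|S-T\|_r\le F_r(S,T)\le\sqrt{1-\tfrac14\|S-T\|_r^2}$. 2. (Symmetry)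 $F_r(S,T)=F_r(T,S)$. 3. (Joint concavity) If $S^1,\dots,S^n$ and $T^1,\dots,T^n$ are $r$-round strategies and $\lambda_1,\dots,\lambda_n\ge0$ satisfy $\sum_i\lambda_i=1$, then $\sum_i\lambda_iS^i$ and $\sum_i\lambda_iT^i$ are $r$-round strategies and $$F_r\Big(\sum_i\lambda_iS^i,\sum_i\lambda_iT^i\Big)\ge\sum_i\lambda_iF_r(S^i,T^i).$$ 4. (Bounds) $0\le F_r(S,T)\le1$; $F_r(S,T)=1$ if and only if $S=T$; and $F_r(S,T)=0$ if and only if $S$ and $T$ are perfectly distinguishable. -/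

import Mathlib

open scoped Matrix MatrixOrder ComplexOrder Kronecker

namespace QuantumStrategy

/-! Conventions.  A complex Euclidean space with a fixed standard basis is represented by a finite
nonempty index type for the basis, and an operator between such spaces by its matrix.  Rounds are
numbered from `0` to `r - 1`.  Alice's `k`-th message space is `Y k`.  Bob's message spaces are
`X 0, …, X (r - 1)`, followed by `X r`, the auxiliary one-dimensional space `ℂ`, which is expressed
by the assumption `[Unique (X (Fin.last r))]`.  Memory spaces are `ℂ ^ m` with basis `Fin m`. -/

section States

variable {n : Type*} [Fintype n] [DecidableEq n]

/-- The trace norm `‖M‖₁ = Tr √(M* M)`. -/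
noncomputable def traceNorm (M : Matrix n n ℂ) : ℝ :=
  (CFC.sqrt (Mᴴ * M)).trace.re

/-- The fidelity `F(P, Q) = ‖√P √Q‖₁` of two positive semidefinite operators. -/
noncomputable def fidelity (P Q : Matrix n n ℂ) : ℝ :=
  traceNorm (CFC.sqrt P * CFC.sqrt Q)

/-- Two density operators are perfectly distinguishable if some two-outcome measurement `(P₀, P₁)`
identifies each of them with certainty. -/
def StatesPerfectlyDistinguishable (ρ ξ : Matrix n n ℂ) : Prop :=
  ∃ P₀ P₁ : Matrix n n ℂ, P₀.PosSemidef ∧ P₁.PosSemidef ∧ P₀ + P₁ = 1 ∧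
    (P₀ * ρ).trace = 1 ∧ (P₁ * ξ).trace = 1

end States

/-- A matrix is (the matrix of) a linear isometry. -/
def IsIsometry {a b : Type*} [Fintype b] [DecidableEq a] (M : Matrix b a ℂ) : Prop :=
  Mᴴ * M = 1

/-- The partial trace over the second tensor factor. -/
def partialTraceRight {a m : Type*} [Fintype m] (M : Matrix (a × m) (a × m) ℂ) : Matrix a a ℂ :=
  Matrix.of fun i j => ∑ z, M (i, z) (j, z)

/-- The Choi–Jamiołkowski matrix `∑ Φ(|i⟩⟨j|) ⊗ |i⟩⟨j|` of a map `Φ : L(ℂ^a) → L(ℂ^b)`;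
it acts on `ℂ^b ⊗ ℂ^a`. -/
def choi {a b : Type*} [DecidableEq a] (Φ : Matrix a a ℂ → Matrix b b ℂ) :
    Matrix (b × a) (b × a) ℂ :=
  Matrix.of fun p q => Φ (Matrix.single p.2 q.2 1) p.1 q.1

/-- The map `M ↦ Tr_Z (V M V*)` determined by `V : ℂ^a → ℂ^b ⊗ Z`. -/
def channel {a b z : Type*} [Fintype a] [Fintype z]
    (V : Matrix (b × z) a ℂ) (M : Matrix a a ℂ) : Matrix b b ℂ :=
  partialTraceRight (V * M * Vᴴ)

/-- The map `N ↦ V* (N ⊗ I_Z) V`, the adjoint of `channel V` (see `channel_adjoint`). -/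
def adjointChannel {a b z : Type*} [Fintype b] [Fintype z] [DecidableEq z]
    (V : Matrix (b × z) a ℂ) (N : Matrix b b ℂ) : Matrix a a ℂ :=
  Vᴴ * (N ⊗ₖ (1 : Matrix z z ℂ)) * V

/-- `adjointChannel V` is the adjoint of `channel V` for the Hilbert–Schmidt inner product. -/
theorem channel_adjoint {a b z : Type*} [Fintype a] [Fintype b] [Fintype z] [DecidableEq z]
    (V : Matrix (b × z) a ℂ) (M : Matrix a a ℂ) (N : Matrix b b ℂ) :
    (Nᴴ * channel V M).trace = ((adjointChannel V N)ᴴ * M).trace := by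
  have key : ∀ K : Matrix (b × z) (b × z) ℂ,
      (Nᴴ * partialTraceRight K).trace = ((Nᴴ ⊗ₖ (1 : Matrix z z ℂ)) * K).trace := by
    intro K
    simp only [Matrix.trace, Matrix.diag, Matrix.mul_apply, partialTraceRight, Matrix.of_apply,
      Fintype.sum_prod_type, Matrix.kroneckerMap_apply, Matrix.one_apply, mul_ite, mul_one,
      mul_zero, ite_mul, zero_mul, Finset.sum_ite_eq, Finset.mem_univ, if_true, Finset.mul_sum]
    exact Finset.sum_congr rfl fun i _ => Finset.sum_comm
  have h : (adjointChannel V N)ᴴ = Vᴴ * (Nᴴ ⊗ₖ (1 : Matrix z z ℂ)) * V := by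
    simp [adjointChannel, Matrix.conjTranspose_mul, Matrix.conjTranspose_kronecker,
      Matrix.mul_assoc]
  rw [channel, key, h, ← Matrix.mul_assoc, Matrix.trace_mul_comm]
  simp only [Matrix.mul_assoc]

section Strategies

variable {r : ℕ} (X : Fin (r + 1) → Type*) (Y : Fin r → Type*)
  [∀ k, Fintype (X k)] [∀ k, DecidableEq (X k)] [Unique (X (Fin.last r))]
  [∀ k, Fintype (Y k)] [∀ k, DecidableEq (Y k)]

/-- An `r`-round pure strategy.  Its memory spaces are `ℂ ^ mem 0 = ℂ, ℂ ^ mem 1, …, ℂ ^ mem r`,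
the last one being the final memory space, and `A k` maps `X k ⊗ ℂ ^ mem k` isometrically to
`Y k ⊗ ℂ ^ mem (k + 1)`. -/
structure PureStrategy where
  mem : Fin (r + 1) → ℕ
  mem_zero : mem 0 = 1
  A : ∀ k : Fin r, Matrix (Y k × Fin (mem k.succ)) (X k.castSucc × Fin (mem k.castSucc)) ℂ
  isometry : ∀ k, IsIsometry (A k)

/-- An `r`-round pure co-strategy, with memory spaces `ℂ ^ mem 0, …, ℂ ^ mem r`, the last one being
the final memory space, a unit vector `β` in `X 0 ⊗ ℂ ^ mem 0` (the initial state) and isometries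
`B k` from `Y k ⊗ ℂ ^ mem k` to `X (k + 1) ⊗ ℂ ^ mem (k + 1)`. -/
structure PureCoStrategy where
  mem : Fin (r + 1) → ℕ
  β : X 0 × Fin (mem 0) → ℂ
  norm_β : ∑ p, ‖β p‖ ^ 2 = 1
  B : ∀ k : Fin r, Matrix (X k.succ × Fin (mem k.succ)) (Y k × Fin (mem k.castSucc)) ℂ
  isometry : ∀ k, IsIsometry (B k)

/-- Basis of `Y_1 ⊗ ⋯ ⊗ Y_r`. -/
abbrev OutIdx := ∀ k : Fin r, Y k

/-- Basis of `X_1 ⊗ ⋯ ⊗ X_r`. -/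
abbrev InIdx := ∀ k : Fin r, X k.castSucc

/-- Operators on `(Y_1 ⊗ ⋯ ⊗ Y_r) ⊗ (X_1 ⊗ ⋯ ⊗ X_r)`. -/
abbrev Op := Matrix (OutIdx Y × InIdx X) (OutIdx Y × InIdx X) ℂ

variable {X Y}

namespace PureStrategy

/-- The amplitude of reaching memory basis state `z` after the first `k` rounds, when the messages
received are `x` and the messages sent are `y`. -/
def amplitude (A : PureStrategy X Y) (y : OutIdx Y) (x : InIdx X) :
    ∀ k : Fin (r + 1), Fin (A.mem k) → ℂ :=
  Fin.induction (motive := fun k => Fin (A.mem k) → ℂ) (fun _ => 1)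
    fun k v z' => ∑ z, A.A k (y k, z') (x k, z) * v z

/-- The single isometry `(A_r ⊗ I) ⋯ (I ⊗ A_2 ⊗ I)(I ⊗ A_1)` from `X_1 ⊗ ⋯ ⊗ X_r` to
`Y_1 ⊗ ⋯ ⊗ Y_r ⊗ Z_r`, written out in the standard bases. -/
def isometryMatrix (A : PureStrategy X Y) :
    Matrix (OutIdx Y × Fin (A.mem (Fin.last r))) (InIdx X) ℂ :=
  Matrix.of fun p x => A.amplitude p.1 x (Fin.last r) p.2

/-- The strategy obtained from a pure strategy by tracing out the final memory space, as an
operator: the Choi–Jamiołkowski matrix of `M ↦ Tr_{Z_r} (Ã M Ã*)`. -/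
def strategy (A : PureStrategy X Y) : Op X Y :=
  choi (channel A.isometryMatrix)

end PureStrategy

namespace PureCoStrategy

/-- The amplitude of reaching memory basis state `w` after the first `k` rounds, when the messages
sent are `x` and the messages received are `y`. -/
def amplitude (B : PureCoStrategy X Y) (x : ∀ k, X k) (y : OutIdx Y) :
    ∀ k : Fin (r + 1), Fin (B.mem k) → ℂ :=
  Fin.induction (motive := fun k => Fin (B.mem k) → ℂ) (fun w => B.β (x 0, w))
    fun k v w' => ∑ w, B.B k (x k.succ, w') (y k, w) * v w

/-- The single isometry `(B_r ⊗ I) ⋯ (I ⊗ B_1 ⊗ I)(I ⊗ |β⟩)` from `Y_1 ⊗ ⋯ ⊗ Y_r` to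
`X_1 ⊗ ⋯ ⊗ X_r ⊗ W_r`, written out in the standard bases; the last, one-dimensional message space
contributes its only basis vector. -/
def isometryMatrix (B : PureCoStrategy X Y) :
    Matrix (InIdx X × Fin (B.mem (Fin.last r))) (OutIdx Y) ℂ :=
  Matrix.of fun p y => B.amplitude (Fin.snoc (α := X) p.1 default) y (Fin.last r) p.2

/-- The co-strategy obtained from a pure co-strategy by tracing out the final memory space, as an
operator: the Choi–Jamiołkowski matrix of the adjoint of `N ↦ Tr_{W_r} (B̃ N B̃*)`. -/
def coStrategy (B : PureCoStrategy X Y) : Op X Y :=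
  choi (adjointChannel B.isometryMatrix)

end PureCoStrategy

/-- The operator `S` is an `r`-round strategy. -/
def IsStrategy (S : Op X Y) : Prop := ∃ A : PureStrategy X Y, A.strategy = S

/-- The operator `B` is an `r`-round co-strategy. -/
def IsCoStrategy (B : Op X Y) : Prop := ∃ C : PureCoStrategy X Y, C.coStrategy = B

/-- The joint state on `X_{k+1} ⊗ Z_k ⊗ W_k` after `k` rounds of interaction: initially `|β⟩`, and
in each round first `A_k ⊗ I` and then `I ⊗ B_k` is applied. -/
def stateAfter (A : PureStrategy X Y) (B : PureCoStrategy X Y) :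
    ∀ k : Fin (r + 1), X k → Fin (A.mem k) → Fin (B.mem k) → ℂ :=
  Fin.induction (motive := fun k => X k → Fin (A.mem k) → Fin (B.mem k) → ℂ)
    (fun x _ w => B.β (x, w))
    fun k ψ x' z' w' =>
      ∑ y, ∑ w, B.B k (x', w') (y, w) * ∑ x, ∑ z, A.A k (y, z') (x, z) * ψ x z w

/-- The final state `|ψ(Ã, B̃)⟩` in `Z_r ⊗ W_r`. -/
def finalState (A : PureStrategy X Y) (B : PureCoStrategy X Y)
    (z : Fin (A.mem (Fin.last r))) (w : Fin (B.mem (Fin.last r))) : ℂ :=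
  stateAfter A B (Fin.last r) default z w

/-- The reduced state `Tr_{Z_r} |ψ(Ã, B̃)⟩⟨ψ(Ã, B̃)|` of the final memory space of `B̃`. -/
def finalMix (A : PureStrategy X Y) (B : PureCoStrategy X Y) :
    Matrix (Fin (B.mem (Fin.last r))) (Fin (B.mem (Fin.last r))) ℂ :=
  Matrix.of fun w w' => ∑ z, finalState A B z w * star (finalState A B z w')

/-- The set of all values `F(ρ_S(B̃), ρ_T(B̃))`, over all compatible pure co-strategies `B̃`.  The
states are computed from purifications of `S` and `T`, on whose choice they do not depend. -/
def fidelityValues (S T : Op X Y) : Set ℝ :=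
  {f | ∃ A A' : PureStrategy X Y, A.strategy = S ∧ A'.strategy = T ∧
    ∃ B : PureCoStrategy X Y, f = fidelity (finalMix A B) (finalMix A' B)}

/-- The strategy fidelity `F_r(S, T) = min_B F(ρ_S(B̃), ρ_T(B̃))`. -/
noncomputable def strategyFidelity (S T : Op X Y) : ℝ := sInf (fidelityValues S T)

/-- The set of all values `⟨B₀ - B₁, H⟩` with `B₀, B₁ ≥ 0` and `B₀ + B₁` a co-strategy. -/
def normValues (H : Op X Y) : Set ℝ :=
  {v | ∃ B₀ B₁ : Op X Y, B₀.PosSemidef ∧ B₁.PosSemidef ∧ IsCoStrategy (B₀ + B₁) ∧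
    v = ((B₀ - B₁)ᴴ * H).trace.re}

/-- The strategy norm `‖H‖_r` of a Hermitian operator `H`. -/
noncomputable def strategyNorm (H : Op X Y) : ℝ := sSup (normValues H)

/-- `S` and `T` are perfectly distinguishable: after interacting with a suitable pure co-strategy,
a measurement of its final memory space tells with certainty which of the two it was. -/
def PerfectlyDistinguishable (S T : Op X Y) : Prop :=
  ∃ A A' : PureStrategy X Y, A.strategy = S ∧ A'.strategy = T ∧
    ∃ B : PureCoStrategy X Y, StatesPerfectlyDistinguishable (finalMix A B) (finalMix A' B)

end Strategies

end QuantumStrategy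

/-! Everything reduces to statements about density matrices. Collect the amplitudes of all message
histories of a pure strategy in a matrix `V` and those of a pure co-strategy in `N`. Then the
strategy is `V * Vᴴ`, the co-strategy is `Nᴴ * N`, and the final state is the product `N * V`, so
the state left to the co-strategy is `N * S * Nᴴ` (`finalMix_eq`). It is linear in `S` and does not
see the purification.

Since `F(K Kᴴ, L Lᴴ) = ‖Kᴴ L‖₁`, the fidelity after the interaction is `‖√S C √T‖₁` with `C = Nᴴ *
N` (`PureCoStrategy.fidelity_mix`), a continuous function of the co-strategy alone. Co-strategies
form a compact set although memories are unbounded: they are the last members of families of Gram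
matrices subject to closed, bounded conditions, and each such family is realized by isometries,
because vectors with equal Gram matrices differ by an isometry
(`CoStrategyGram.exists_pureCoStrategy`). Hence both extrema are attained.

A splitting of `Nᴴ * N` into two positive parts comes from a measurement of the final memory
(`exists_measurement_of_add_eq`), so the strategy norm is the best measurement bias between the two
final states. The Fuchs–van de Graaf inequalities then follow from those for states at an optimal
co-strategy. Joint concavity follows likewise, with convexity of the Gram conditions showing that
mixtures are strategies. Faithfulness holds because a positive multiple of the identity is a
co-strategy, and fidelity zero is settled by the state case at an attained minimum. -/

namespace QuantumStrategy

set_option linter.unusedSectionVars false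

/-! ### Trace norm, fidelity and measurements for matrices. -/

section MatrixLemmas

open Matrix

variable {ι m n : Type*} [Fintype ι] [Fintype m] [Fintype n]
  [DecidableEq ι] [DecidableEq m] [DecidableEq n]

omit [DecidableEq n] in
theorem inner_toEuclideanLin (A : Matrix n ι ℂ) (x y : EuclideanSpace ℂ ι) :
    inner ℂ (toEuclideanLin A x) (toEuclideanLin A y) = star x.ofLp ⬝ᵥ ((Aᴴ * A) *ᵥ y.ofLp) := by
  rw [EuclideanSpace.inner_eq_star_dotProduct, ← mulVec_mulVec, dotProduct_mulVec,
    ← star_mulVec, dotProduct_comm]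
  rfl

/-- Equal Gram matrices make `A x ↦ B x` a well-defined isometry on the range of `A`; in the square
case it extends to the whole space. -/
theorem exists_isometry_mul_eq_of_square {A B : Matrix n ι ℂ} (h : Aᴴ * A = Bᴴ * B) :
    ∃ T : Matrix n n ℂ, IsIsometry T ∧ T * A = B := by
  have hn : ∀ x, ‖toEuclideanLin A x‖ = ‖toEuclideanLin B x‖ := fun x => by
    rw [@norm_eq_sqrt_re_inner ℂ, @norm_eq_sqrt_re_inner ℂ, inner_toEuclideanLin,
      inner_toEuclideanLin, h]
  set f := toEuclideanLin A
  set g := toEuclideanLin B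
  obtain ⟨s, hs⟩ := LinearMap.exists_rightInverse_of_surjective f.rangeRestrict
    f.range_rangeRestrict
  have hs' : ∀ y, f (s y) = y := fun y => congrArg Subtype.val (LinearMap.congr_fun hs y)
  let L : LinearMap.range f →ₗᵢ[ℂ] EuclideanSpace ℂ n :=
    { toLinearMap := g ∘ₗ s
      norm_map' := fun y => by
        rw [LinearMap.comp_apply, ← hn, hs']
        rfl }
  have hL : ∀ x, L.extend (f x) = g x := fun x => by
    have h1 := L.extend_apply ⟨f x, LinearMap.mem_range_self f x⟩
    rw [show L.extend (f x) = _ from h1]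
    change g (s _) = g x
    -- The choice of preimage is irrelevant: `f` and `g` have equal norms, hence equal kernels.
    rw [← sub_eq_zero, ← map_sub, ← norm_eq_zero, ← hn, map_sub, hs', sub_self, norm_zero]
  refine ⟨toEuclideanLin.symm L.extend.toLinearMap, ?_, ?_⟩
  · rw [IsIsometry]
    ext i j
    have h2 := inner_toEuclideanLin (toEuclideanLin.symm L.extend.toLinearMap)
      (EuclideanSpace.single i 1) (EuclideanSpace.single j 1)
    rw [LinearEquiv.apply_symm_apply] at h2
    simp only [LinearIsometry.coe_toLinearMap, LinearIsometry.inner_map_map] at h2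
    rw [EuclideanSpace.inner_single_left, PiLp.single_apply] at h2
    simpa [Matrix.one_apply] using h2.symm
  · apply toEuclideanLin.injective
    ext x : 1
    rw [← hL]
    simp [toEuclideanLin, f]

/-- Two matrices with the same Gram matrix differ by an isometry. -/
theorem exists_isometry_mul_eq {A : Matrix m ι ℂ} {B : Matrix n ι ℂ} (h : Aᴴ * A = Bᴴ * B)
    (hc : Fintype.card m ≤ Fintype.card n) :
    ∃ T : Matrix n m ℂ, IsIsometry T ∧ T * A = B := by
  obtain ⟨e⟩ := Function.Embedding.nonempty_of_card_le hc
  -- A coordinate embedding pads `A` with zero rows, which reduces to the square case.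
  let J : Matrix n m ℂ := Matrix.of fun i j => if i = e j then 1 else 0
  have hJ : Jᴴ * J = 1 := by
    ext i j
    simp [J, Matrix.mul_apply, Matrix.one_apply, eq_comm]
  have h' : (J * A)ᴴ * (J * A) = Bᴴ * B := by
    rw [conjTranspose_mul, Matrix.mul_assoc, ← Matrix.mul_assoc Jᴴ, hJ, Matrix.one_mul, h]
  obtain ⟨T, hT, hTA⟩ := exists_isometry_mul_eq_of_square h'
  refine ⟨T * J, ?_, by rw [Matrix.mul_assoc, hTA]⟩
  rw [IsIsometry] at *
  rw [conjTranspose_mul, Matrix.mul_assoc, ← Matrix.mul_assoc Tᴴ, hT, Matrix.one_mul, hJ]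

theorem posSemidef_sqrt (A : Matrix n n ℂ) : (CFC.sqrt A).PosSemidef :=
  nonneg_iff_posSemidef.1 (CFC.sqrt_nonneg A)

theorem sqrt_mul_sqrt {A : Matrix n n ℂ} (hA : A.PosSemidef) : CFC.sqrt A * CFC.sqrt A = A :=
  CFC.sqrt_mul_sqrt_self A (nonneg_iff_posSemidef.2 hA)

theorem conjTranspose_sqrt (A : Matrix n n ℂ) : (CFC.sqrt A)ᴴ = CFC.sqrt A :=
  (posSemidef_sqrt A).1

theorem conjTranspose_sqrt_mul_sqrt {A : Matrix n n ℂ} (hA : A.PosSemidef) :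
    (CFC.sqrt A)ᴴ * CFC.sqrt A = A := by
  rw [conjTranspose_sqrt, sqrt_mul_sqrt hA]

theorem exists_polar (M : Matrix n n ℂ) :
    ∃ U : Matrix n n ℂ, IsIsometry U ∧ U * CFC.sqrt (Mᴴ * M) = M :=
  exists_isometry_mul_eq
    (conjTranspose_sqrt_mul_sqrt (posSemidef_conjTranspose_mul_self M)) le_rfl

theorem PosSemidef.trace_mul_nonneg {A B : Matrix n n ℂ} (hA : A.PosSemidef)
    (hB : B.PosSemidef) : 0 ≤ (A * B).trace := by
  rw [← conjTranspose_sqrt_mul_sqrt hB, ← Matrix.mul_assoc, trace_mul_comm, ← Matrix.mul_assoc]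
  exact (hA.mul_mul_conjTranspose_same _).trace_nonneg

omit [DecidableEq n] in
theorem re_trace_conjTranspose (A : Matrix n n ℂ) : Aᴴ.trace.re = A.trace.re := by
  simp [trace_conjTranspose]

/-- Expand `0 ≤ Tr ((1 - U)ᴴ (1 - U) P)`. -/
theorem re_trace_isometry_mul_le {P U : Matrix n n ℂ} (hP : P.PosSemidef) (hU : IsIsometry U) :
    (U * P).trace.re ≤ P.trace.re := by
  have h := PosSemidef.trace_mul_nonneg (posSemidef_conjTranspose_mul_self (1 - U)) hP
  have e : (1 - U)ᴴ * (1 - U) = 1 + 1 - U - Uᴴ := by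
    rw [IsIsometry] at hU
    rw [conjTranspose_sub, conjTranspose_one, sub_mul, mul_sub, mul_sub, hU]
    simp
    abel
  have h2 : (Uᴴ * P).trace.re = (U * P).trace.re := by
    rw [← re_trace_conjTranspose (U * P), conjTranspose_mul, hP.1.eq, trace_mul_comm]
  rw [e] at h
  have h3 := (Complex.le_def.1 h).1
  simp only [sub_mul, add_mul, Matrix.one_mul, trace_sub, trace_add, Complex.sub_re,
    Complex.add_re, Complex.zero_re, h2] at h3
  linarith

theorem IsIsometry.mul {A B : Matrix n n ℂ} (hA : IsIsometry A) (hB : IsIsometry B) :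
    IsIsometry (A * B) := by
  rw [IsIsometry] at *
  rw [conjTranspose_mul, Matrix.mul_assoc, ← Matrix.mul_assoc Aᴴ, hA, Matrix.one_mul, hB]

/-- By polar decomposition. With `exists_isometry_trace_eq_traceNorm` this gives the variational
formula `‖M‖₁ = max Re Tr (U M)` over unitaries. -/
theorem re_trace_mul_le_traceNorm {M U : Matrix n n ℂ} (hU : IsIsometry U) :
    (U * M).trace.re ≤ traceNorm M := by
  obtain ⟨V, hV, hM⟩ := exists_polar M
  conv_lhs => rw [← hM, ← Matrix.mul_assoc]
  exact re_trace_isometry_mul_le (posSemidef_sqrt _) (hU.mul hV)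

theorem exists_isometry_trace_eq_traceNorm (M : Matrix n n ℂ) :
    ∃ U : Matrix n n ℂ, IsIsometry U ∧ (U * M).trace.re = traceNorm M := by
  obtain ⟨V, hV, hM⟩ := exists_polar M
  have hV' : V * Vᴴ = 1 := mul_eq_one_comm.1 hV
  refine ⟨Vᴴ, by rw [IsIsometry, conjTranspose_conjTranspose, hV'], ?_⟩
  conv_lhs => rw [← hM, ← Matrix.mul_assoc, show Vᴴ * V = 1 from hV, Matrix.one_mul]
  rfl

theorem traceNorm_nonneg (M : Matrix n n ℂ) : 0 ≤ traceNorm M :=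
  (Complex.le_def.1 (posSemidef_sqrt _).trace_nonneg).1

theorem IsIsometry.one : IsIsometry (1 : Matrix n n ℂ) := by
  simp [IsIsometry]

/-- If `A = T P` with `P = √(Aᴴ A)` and `T` an isometry, then `T P Tᴴ` is the positive root of `A
Aᴴ`, and it has the trace of `P`. -/
theorem trace_sqrt_swap_of_card_le (A : Matrix m n ℂ) (hc : Fintype.card n ≤ Fintype.card m) :
    (CFC.sqrt (A * Aᴴ)).trace = (CFC.sqrt (Aᴴ * A)).trace := by
  obtain ⟨T, hT, hTA⟩ := exists_isometry_mul_eq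
    (conjTranspose_sqrt_mul_sqrt (posSemidef_conjTranspose_mul_self A)) hc
  set P := CFC.sqrt (Aᴴ * A) with hP
  have hPs : P.PosSemidef := posSemidef_sqrt _
  have h : CFC.sqrt (A * Aᴴ) = T * P * Tᴴ := by
    apply CFC.sqrt_unique _ (nonneg_iff_posSemidef.2 (hPs.mul_mul_conjTranspose_same T))
    rw [← hTA, conjTranspose_mul, hPs.1.eq]
    simp only [Matrix.mul_assoc]
    rw [← Matrix.mul_assoc Tᴴ T, show Tᴴ * T = 1 from hT, Matrix.one_mul]
  rw [h, trace_mul_comm, ← Matrix.mul_assoc, show Tᴴ * T = 1 from hT, Matrix.one_mul]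

theorem trace_sqrt_swap (A : Matrix m n ℂ) :
    (CFC.sqrt (A * Aᴴ)).trace = (CFC.sqrt (Aᴴ * A)).trace := by
  rcases le_total (Fintype.card n) (Fintype.card m) with hc | hc
  · exact trace_sqrt_swap_of_card_le A hc
  · simpa using (trace_sqrt_swap_of_card_le Aᴴ hc).symm

/-- The fidelity of two operators in terms of square factors of them. -/
theorem fidelity_mul_conjTranspose (K L : Matrix n m ℂ) :
    fidelity (K * Kᴴ) (L * Lᴴ) = traceNorm (Kᴴ * L) := by
  set Q := CFC.sqrt (L * Lᴴ) with hQ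
  have hQh : Qᴴ = Q := conjTranspose_sqrt _
  have hQQ : Q * Q = L * Lᴴ := sqrt_mul_sqrt (posSemidef_self_mul_conjTranspose L)
  -- The trace norm of `M` depends only on `Mᴴ M`, or equally on `M Mᴴ`: the first form replaces one
  -- root by `Kᴴ`, the second replaces the other by `L`.
  have h1 : (CFC.sqrt (K * Kᴴ) * Q)ᴴ * (CFC.sqrt (K * Kᴴ) * Q) = (Kᴴ * Q)ᴴ * (Kᴴ * Q) := by
    simp only [conjTranspose_mul, conjTranspose_sqrt, conjTranspose_conjTranspose,
      Matrix.mul_assoc]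
    rw [← Matrix.mul_assoc (CFC.sqrt _) (CFC.sqrt _),
      sqrt_mul_sqrt (posSemidef_self_mul_conjTranspose K), Matrix.mul_assoc]
  have h2 : (Kᴴ * Q) * (Kᴴ * Q)ᴴ = (Kᴴ * L) * (Kᴴ * L)ᴴ := by
    simp only [conjTranspose_mul, conjTranspose_conjTranspose, hQh, Matrix.mul_assoc]
    rw [← Matrix.mul_assoc Q Q, hQQ, Matrix.mul_assoc]
  rw [fidelity, traceNorm, traceNorm, h1, ← trace_sqrt_swap, h2, trace_sqrt_swap]

theorem traceNorm_conjTranspose (M : Matrix n n ℂ) : traceNorm Mᴴ = traceNorm M := by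
  rw [traceNorm, traceNorm, conjTranspose_conjTranspose, trace_sqrt_swap]

theorem fidelity_comm (P Q : Matrix n n ℂ) : fidelity P Q = fidelity Q P := by
  rw [fidelity, fidelity, ← traceNorm_conjTranspose, conjTranspose_mul, conjTranspose_sqrt,
    conjTranspose_sqrt]

/-- Cauchy–Schwarz for the Hilbert–Schmidt product, from the discriminant of `t ↦ ‖A - t B‖²`. -/
theorem re_trace_conjTranspose_mul_le (A B : Matrix m n ℂ) :
    (Aᴴ * B).trace.re ≤ Real.sqrt ((Aᴴ * A).trace.re * (Bᴴ * B).trace.re) := by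
  have h : ∀ t : ℝ, 0 ≤ (Bᴴ * B).trace.re * (t * t) + (-2 * (Aᴴ * B).trace.re) * t +
      (Aᴴ * A).trace.re := fun t => by
    have h1 := (Complex.le_def.1
      (posSemidef_conjTranspose_mul_self (A - (t : ℂ) • B)).trace_nonneg).1
    have h2 : (Bᴴ * A).trace.re = (Aᴴ * B).trace.re := by
      rw [← re_trace_conjTranspose, conjTranspose_mul, conjTranspose_conjTranspose]
    simp only [conjTranspose_sub, conjTranspose_smul, Matrix.sub_mul, Matrix.mul_sub, Matrix.smul_mul,
      Matrix.mul_smul, trace_sub, trace_smul, smul_eq_mul, Complex.sub_re, RCLike.star_def,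
      Complex.conj_ofReal, Complex.re_ofReal_mul, h2, Complex.zero_re] at h1
    linarith
  have h3 := discrim_le_zero h
  rw [discrim] at h3
  apply Real.le_sqrt_of_sq_le
  linarith

/-- The fidelity is at most the classical fidelity of the outcomes of a measurement. -/
theorem fidelity_le_sqrt_add_sqrt {P Q E₀ E₁ : Matrix n n ℂ} (hP : P.PosSemidef)
    (hQ : Q.PosSemidef) (h₀ : E₀.PosSemidef) (h₁ : E₁.PosSemidef) (h : E₀ + E₁ = 1) :
    fidelity P Q ≤ Real.sqrt ((E₀ * P).trace.re * (E₀ * Q).trace.re) +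
      Real.sqrt ((E₁ * P).trace.re * (E₁ * Q).trace.re) := by
  obtain ⟨U, hU, hF⟩ := exists_isometry_trace_eq_traceNorm (CFC.sqrt P * CFC.sqrt Q)
  have hpp := sqrt_mul_sqrt hP
  have hqq := sqrt_mul_sqrt hQ
  have hph := conjTranspose_sqrt P
  have hqh := conjTranspose_sqrt Q
  rw [fidelity]
  generalize CFC.sqrt P = p at *
  generalize CFC.sqrt Q = q at *
  subst hpp hqq
  -- The identity between the two roots is split as `E₀ + E₁`, and Cauchy–Schwarz bounds each term.
  have key : ∀ E : Matrix n n ℂ, E.PosSemidef →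
      (U * (p * E * q)).trace.re ≤
        Real.sqrt ((E * (p * p)).trace.re * (E * (q * q)).trace.re) := fun E hE => by
    have hee := sqrt_mul_sqrt hE
    have heh := conjTranspose_sqrt E
    generalize CFC.sqrt E = e at *
    subst hee
    have hc := re_trace_conjTranspose_mul_le (e * p * Uᴴ) (e * q)
    have e1 : (e * p * Uᴴ)ᴴ * (e * q) = U * (p * (e * e) * q) := by
      simp only [conjTranspose_mul, conjTranspose_conjTranspose, hph, heh, Matrix.mul_assoc]
    have e2 : ((e * p * Uᴴ)ᴴ * (e * p * Uᴴ)).trace = (e * e * (p * p)).trace := by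
      calc ((e * p * Uᴴ)ᴴ * (e * p * Uᴴ)).trace = (U * (p * e * e * p * Uᴴ)).trace := by
            simp only [conjTranspose_mul, conjTranspose_conjTranspose, hph, heh,
              Matrix.mul_assoc]
        _ = (p * (e * e * p)).trace := by
            rw [trace_mul_comm, Matrix.mul_assoc, show Uᴴ * U = 1 from hU]
            simp only [Matrix.mul_one, Matrix.mul_assoc]
        _ = _ := by rw [trace_mul_comm, Matrix.mul_assoc]
    have e3 : ((e * q)ᴴ * (e * q)).trace = (e * e * (q * q)).trace := by
      calc ((e * q)ᴴ * (e * q)).trace = (q * (e * e * q)).trace := by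
            simp only [conjTranspose_mul, hqh, heh, Matrix.mul_assoc]
        _ = _ := by rw [trace_mul_comm, Matrix.mul_assoc]
    rwa [e1, e2, e3] at hc
  calc traceNorm (p * q) = (U * (p * (E₀ + E₁) * q)).trace.re := by
        rw [h, Matrix.mul_one, hF]
    _ = (U * (p * E₀ * q)).trace.re + (U * (p * E₁ * q)).trace.re := by
        simp only [mul_add, add_mul, trace_add, Complex.add_re]
    _ ≤ _ := add_le_add (key E₀ h₀) (key E₁ h₁)

/-- `N₀` and `N₁` are the positive and negative parts of `D`, and `E₀`, `E₁` the spectral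
projections for eigenvalues `≥ 0` and `< 0`. So `E₀ - E₁` is a sign of `D` and its product with `D`
is `|D|`. -/
theorem exists_sign_decomposition {D : Matrix n n ℂ} (hD : D.IsHermitian) :
    ∃ E₀ E₁ N₀ N₁ : Matrix n n ℂ, E₀.PosSemidef ∧ E₁.PosSemidef ∧ E₀ + E₁ = 1 ∧
      N₀.PosSemidef ∧ N₁.PosSemidef ∧ D = N₀ - N₁ ∧
      (E₀ - E₁) * D = N₀ + N₁ ∧ D * (E₀ - E₁) = N₀ + N₁ := by
  obtain ⟨U, l, hU, hDU⟩ : ∃ (U : Matrix n n ℂ) (l : n → ℝ), IsIsometry U ∧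
      D = U * diagonal (fun i => (l i : ℂ)) * Uᴴ := by
    refine ⟨hD.eigenvectorUnitary, hD.eigenvalues, ?_, ?_⟩
    · exact Unitary.coe_star_mul_self _
    · conv_lhs => rw [hD.spectral_theorem, Unitary.conjStarAlgAut_apply]
      rfl
  let f : (n → ℝ) → Matrix n n ℂ := fun l => U * diagonal (fun i => (l i : ℂ)) * Uᴴ
  have fp : ∀ l, 0 ≤ l → (f l).PosSemidef := fun l hl =>
    PosSemidef.mul_mul_conjTranspose_same
      (PosSemidef.diagonal fun i => by simpa using hl i) U
  have fadd : ∀ l l', f l + f l' = f (l + l') := fun l l' => by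
    simp only [f, ← add_mul, ← mul_add, diagonal_add, Pi.add_apply, Complex.ofReal_add]
  have fsub : ∀ l l', f l - f l' = f (l - l') := fun l l' => by
    simp only [f, ← sub_mul, ← mul_sub, diagonal_sub, Pi.sub_apply, Complex.ofReal_sub]
  have fmul : ∀ l l', f l * f l' = f (l * l') := fun l l' => by
    simp only [f, Matrix.mul_assoc, Pi.mul_apply, Complex.ofReal_mul, ← diagonal_mul_diagonal]
    rw [← Matrix.mul_assoc Uᴴ U, show Uᴴ * U = 1 from hU, Matrix.one_mul]
  have fone : f 1 = 1 := by
    simp only [f, Pi.one_apply, Complex.ofReal_one, diagonal_one, Matrix.mul_one]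
    exact mul_eq_one_comm.1 hU
  have hDf : D = f l := hDU
  refine ⟨f fun i => if 0 ≤ l i then 1 else 0, f fun i => if 0 ≤ l i then 0 else 1,
    f fun i => max (l i) 0, f fun i => max (-l i) 0, fp _ fun i => ?_, fp _ fun i => ?_, ?_,
    fp _ fun i => le_max_right _ _, fp _ fun i => le_max_right _ _, ?_, ?_, ?_⟩
  · dsimp; split_ifs <;> simp
  · dsimp; split_ifs <;> simp
  · rw [fadd, ← fone]
    congr 1
    ext i
    simp only [Pi.add_apply, Pi.one_apply]
    split_ifs <;> simp
  · rw [fsub, hDf]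
    congr 1
    ext i
    simp only [Pi.sub_apply]
    rcases le_total 0 (l i) with h | h <;> simp [h]
  · rw [fsub, fadd, hDf, fmul]
    congr 1
    ext i
    simp only [Pi.sub_apply, Pi.add_apply, Pi.mul_apply]
    split_ifs with h
    · simp [h]
    · simp [(not_le.1 h).le]
  · rw [fsub, fadd, hDf, fmul]
    congr 1
    ext i
    simp only [Pi.sub_apply, Pi.add_apply, Pi.mul_apply]
    split_ifs with h
    · simp [h]
    · simp [(not_le.1 h).le]

/-- Some measurement distinguishes `P` from `Q` at least as well as the fidelity predicts. -/
theorem exists_measurement_ge {P Q : Matrix n n ℂ} (hP : P.PosSemidef) (hQ : Q.PosSemidef) :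
    ∃ E₀ E₁ : Matrix n n ℂ, E₀.PosSemidef ∧ E₁.PosSemidef ∧ E₀ + E₁ = 1 ∧
      P.trace.re + Q.trace.re - 2 * fidelity P Q ≤ ((E₀ - E₁) * (P - Q)).trace.re := by
  -- The measurement is the sign of `√P - √Q`, not of `P - Q`. As in the Powers–Størmer inequality,
  -- with `p = √P` and `q = √Q`, its bias is `Tr (|p - q| (p + q)) ≥ Tr (p - q)²`, which is `Tr P +
  -- Tr Q - 2 Tr (p q)`.
  obtain ⟨E₀, E₁, N₀, N₁, h₀, h₁, h, hN₀, hN₁, hD, hl, hr⟩ := exists_sign_decomposition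
    ((posSemidef_sqrt P).1.sub (posSemidef_sqrt Q).1)
  refine ⟨E₀, E₁, h₀, h₁, h, ?_⟩
  set p := CFC.sqrt P with hp
  set q := CFC.sqrt Q with hq
  have hpp : p * p = P := sqrt_mul_sqrt hP
  have hqq : q * q = Q := sqrt_mul_sqrt hQ
  have e1 : (p - q) * (p + q) + (p + q) * (p - q) = P - Q + (P - Q) := by
    rw [← hpp, ← hqq]; noncomm_ring
  have e2 : ((E₀ - E₁) * (P - Q)).trace = ((N₀ + N₁) * (p + q)).trace := by
    have e3 : ((E₀ - E₁) * ((p - q) * (p + q))).trace = ((N₀ + N₁) * (p + q)).trace := by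
      rw [← Matrix.mul_assoc, hl]
    have e4 : ((E₀ - E₁) * ((p + q) * (p - q))).trace = ((N₀ + N₁) * (p + q)).trace := by
      rw [trace_mul_comm, Matrix.mul_assoc, hr, trace_mul_comm]
    have e5 := congrArg (fun M => ((E₀ - E₁) * M).trace) e1
    simp only [mul_add (E₀ - E₁), trace_add, e3, e4] at e5
    linear_combination -(1 / 2 : ℂ) * e5
  have g1 := (Complex.le_def.1
    (PosSemidef.trace_mul_nonneg hN₀ (posSemidef_sqrt Q))).1
  have g2 := (Complex.le_def.1
    (PosSemidef.trace_mul_nonneg hN₁ (posSemidef_sqrt P))).1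
  have e6 : ((p - q) * (p - q)).trace =
      ((N₀ + N₁) * (p + q)).trace - 2 * (N₀ * q).trace - 2 * (N₁ * p).trace := by
    nth_rw 1 [hD]
    simp only [sub_mul, mul_sub, add_mul, mul_add, trace_sub, trace_add]
    ring
  have e7 : ((p - q) * (p - q)).trace = P.trace + Q.trace - 2 * (p * q).trace := by
    simp only [sub_mul, mul_sub, trace_sub, hpp, hqq]
    rw [trace_mul_comm q p]
    ring
  have g3 : (p * q).trace.re ≤ fidelity P Q := by
    have := re_trace_mul_le_traceNorm (M := p * q) IsIsometry.one
    rwa [Matrix.one_mul] at this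
  have e8 := congrArg Complex.re (e7.symm.trans e6)
  simp only [Complex.sub_re, Complex.add_re, Complex.mul_re, Complex.re_ofNat, Complex.im_ofNat,
    zero_mul, sub_zero, Complex.zero_re] at e8 g1 g2
  rw [e2]
  linarith

/-- Joint concavity of the fidelity. -/
theorem sum_fidelity_le (P Q : ι → Matrix n n ℂ) (c : ι → ℝ) (hP : ∀ i, (P i).PosSemidef)
    (hQ : ∀ i, (Q i).PosSemidef) (hc : ∀ i, 0 ≤ c i) :
    ∑ i, c i * fidelity (P i) (Q i) ≤
      fidelity (∑ i, (c i : ℂ) • P i) (∑ i, (c i : ℂ) • Q i) := by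
  choose U hU hF using fun i =>
    exists_isometry_trace_eq_traceNorm (CFC.sqrt (P i) * CFC.sqrt (Q i))
  -- The blocks `√(c i) √(P i)` stand side by side, so that `K P * (K P)ᴴ` is the mixture. A
  -- block-diagonal isometry of the optimal `U i` then tests the trace norm of `(K P)ᴴ * K Q`.
  let K : (ι → Matrix n n ℂ) → Matrix n (n × ι) ℂ := fun P =>
    Matrix.of fun a b => (Real.sqrt (c b.2) : ℂ) * CFC.sqrt (P b.2) a b.1
  have hcc : ∀ i, (Real.sqrt (c i) : ℂ) * Real.sqrt (c i) = c i := fun i => by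
    rw [← Complex.ofReal_mul, Real.mul_self_sqrt (hc i)]
  have hK : ∀ P : ι → Matrix n n ℂ, (∀ i, (P i).PosSemidef) →
      ∑ i, (c i : ℂ) • P i = K P * (K P)ᴴ := fun P hP => by
    ext a b
    simp only [Matrix.sum_apply, Matrix.smul_apply, smul_eq_mul, Matrix.mul_apply,
      conjTranspose_apply, Fintype.sum_prod_type_right, K, of_apply, star_mul',
      RCLike.star_def, Complex.conj_ofReal]
    refine Finset.sum_congr rfl fun i _ => ?_
    rw [← sqrt_mul_sqrt (hP i), Matrix.mul_apply, Finset.mul_sum, ← hcc]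
    refine Finset.sum_congr rfl fun j _ => ?_
    have h1 := congrFun (congrFun (conjTranspose_sqrt (P i)) j) b
    rw [conjTranspose_apply, RCLike.star_def] at h1
    rw [sqrt_mul_sqrt (hP i), h1]
    ring
  have hU' : IsIsometry (blockDiagonal U) := by
    rw [IsIsometry, blockDiagonal_conjTranspose, ← blockDiagonal_mul, ← blockDiagonal_one]
    exact congrArg _ (funext hU)
  rw [hK P hP, hK Q hQ, fidelity_mul_conjTranspose]
  refine le_trans (le_of_eq ?_) (re_trace_mul_le_traceNorm hU')
  have h2 : (blockDiagonal U * ((K P)ᴴ * K Q)).trace =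
      ∑ i, (c i : ℂ) * (U i * (CFC.sqrt (P i) * CFC.sqrt (Q i))).trace := by
    simp only [trace, diag_apply, Matrix.mul_apply, Fintype.sum_prod_type_right,
      blockDiagonal_apply, ite_mul, zero_mul,
      conjTranspose_apply, K, of_apply, star_mul', RCLike.star_def, Complex.conj_ofReal]
    refine Finset.sum_congr rfl fun i _ => ?_
    simp only [Finset.sum_ite_irrel, Finset.sum_const_zero, Finset.sum_ite_eq,
      Finset.mem_univ, if_true, Finset.mul_sum]
    refine Finset.sum_congr rfl fun j _ => Finset.sum_congr rfl fun k _ =>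
      Finset.sum_congr rfl fun l _ => ?_
    have h1 := congrFun (congrFun (conjTranspose_sqrt (P i)) k) l
    rw [conjTranspose_apply, RCLike.star_def] at h1
    rw [h1, ← hcc]
    ring
  rw [h2, Complex.re_sum]
  refine Finset.sum_congr rfl fun i _ => ?_
  rw [Complex.re_ofReal_mul, hF, fidelity]

/-- A decomposition of `Nᴴ * N` comes from a measurement. -/
theorem exists_measurement_of_add_eq {B₀ B₁ : Matrix n n ℂ} {N : Matrix m n ℂ}
    (h₀ : B₀.PosSemidef) (h₁ : B₁.PosSemidef) (h : B₀ + B₁ = Nᴴ * N) :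
    ∃ E₀ E₁ : Matrix m m ℂ, E₀.PosSemidef ∧ E₁.PosSemidef ∧ E₀ + E₁ = 1 ∧
      Nᴴ * E₀ * N = B₀ ∧ Nᴴ * E₁ * N = B₁ := by
  -- The zero block only makes `G` tall enough for an isometry from `ℂ^m`. It falls into the second
  -- half of the rows, hence into `E₁`.
  let G : Matrix (n ⊕ (n ⊕ m)) n ℂ :=
    fromRows (CFC.sqrt B₀) (fromRows (CFC.sqrt B₁) (0 : Matrix m n ℂ))
  have hG : Nᴴ * N = Gᴴ * G := by
    simp only [G, conjTranspose_fromRows_eq_fromCols_conjTranspose, fromCols_mul_fromRows,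
      conjTranspose_sqrt_mul_sqrt h₀, conjTranspose_sqrt_mul_sqrt h₁, Matrix.mul_zero, add_zero, h]
  obtain ⟨T, hT, hTN⟩ := exists_isometry_mul_eq hG (by simp; omega)
  have hT' : T.toRows₁ᴴ * T.toRows₁ + T.toRows₂ᴴ * T.toRows₂ = 1 := by
    rw [← fromCols_mul_fromRows, ← conjTranspose_fromRows_eq_fromCols_conjTranspose,
      fromRows_toRows]
    exact hT
  have h0 : T.toRows₁ * N = CFC.sqrt B₀ := by
    ext i j
    exact congrFun (congrFun hTN (Sum.inl i)) j
  have h2 : Nᴴ * (T.toRows₁ᴴ * T.toRows₁) * N = B₀ := by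
    rw [← Matrix.mul_assoc, ← conjTranspose_mul, Matrix.mul_assoc, h0,
      conjTranspose_sqrt_mul_sqrt h₀]
  refine ⟨_, _, posSemidef_conjTranspose_mul_self _, posSemidef_conjTranspose_mul_self _, hT',
    h2, ?_⟩
  rw [← add_right_inj B₀, h]
  nth_rw 1 [← h2]
  rw [← Matrix.add_mul, ← Matrix.mul_add, hT', Matrix.mul_one]

section
open scoped Matrix.Norms.L2Operator

theorem continuous_traceNorm : Continuous (traceNorm : Matrix n n ℂ → ℝ) :=
  Complex.continuous_re.comp
    ((CFC.continuous_abs (A := Matrix n n ℂ)).matrix_trace)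

end

end MatrixLemmas
-- Realizing prescribed Gram matrices by vectors and isometries.
section Realization

open Matrix

theorem exists_isometry_of_card_le {m n : Type*} [Fintype m] [Fintype n] [DecidableEq m]
    [DecidableEq n] (hc : Fintype.card m ≤ Fintype.card n) :
    ∃ T : Matrix n m ℂ, IsIsometry T := by
  obtain ⟨T, hT, -⟩ := exists_isometry_mul_eq (A := (0 : Matrix m Unit ℂ))
    (B := (0 : Matrix n Unit ℂ)) (by simp) hc
  exact ⟨T, hT⟩

theorem PosSemidef.exists_eq_mul_conjTranspose {m n : Type*} [Fintype m] [Fintype n]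
    [DecidableEq m] [DecidableEq n] {R : Matrix m m ℂ} (hR : R.PosSemidef)
    (hc : Fintype.card m ≤ Fintype.card n) : ∃ V : Matrix m n ℂ, V * Vᴴ = R := by
  obtain ⟨T, hT⟩ := exists_isometry_of_card_le hc
  refine ⟨CFC.sqrt R * Tᴴ, ?_⟩
  rw [conjTranspose_mul, conjTranspose_conjTranspose, Matrix.mul_assoc, ← Matrix.mul_assoc Tᴴ,
    show Tᴴ * T = 1 from hT, Matrix.one_mul, conjTranspose_sqrt, sqrt_mul_sqrt hR]

theorem row_eq_of_mul_conjTranspose_row_eq {m n : Type*} [Fintype n] {V : Matrix m n ℂ}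
    {p q : m} (h : (V * Vᴴ) p = (V * Vᴴ) q) : V p = V q := by
  have h1 : (V p - V q) ⬝ᵥ star (V p - V q) = 0 := by
    have e : ∀ a b, V a ⬝ᵥ star (V b) = (V * Vᴴ) a b := fun a b => rfl
    rw [star_sub, sub_dotProduct, dotProduct_sub, dotProduct_sub, e, e, e, e, h]
    ring
  exact sub_eq_zero.1 (dotProduct_self_star_eq_zero.1 h1)

/-- An isometry that turns the vectors `V p` into the vectors `V' (upd i o p)`. -/
theorem exists_isometry_step {P I O m m' : Type*} [Fintype P] [Fintype I] [Fintype O] [Fintype m]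
    [Fintype m'] [DecidableEq P] [DecidableEq I] [DecidableEq O] [DecidableEq m]
    [DecidableEq m'] (V : Matrix P m ℂ) (V' : Matrix P m' ℂ) (upd : I → O → P → P)
    (h : ∀ i i' p p', ∑ o, (V' * V'ᴴ) (upd i o p) (upd i' o p') =
      if i = i' then (V * Vᴴ) p p' else 0)
    (hc : Fintype.card I * Fintype.card m ≤ Fintype.card O * Fintype.card m') :
    ∃ T : Matrix (O × m') (I × m) ℂ, IsIsometry T ∧
      ∀ i o p w', ∑ w, T (o, w') (i, w) * V p w = V' (upd i o p) w' := by
  -- The columns of `A` are the inputs `e_i ⊗ V p` and those of `B` the required outputs; `h` says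
  -- that their Gram matrices agree.
  let A : Matrix (I × m) (I × P) ℂ := Matrix.of fun a b => if a.1 = b.1 then V b.2 a.2 else 0
  let B : Matrix (O × m') (I × P) ℂ := Matrix.of fun a b => V' (upd b.1 a.1 b.2) a.2
  have hAB : Aᴴ * A = Bᴴ * B := by
    ext ⟨i, p⟩ ⟨i', p'⟩
    have h1 := h i' i p' p
    simp only [Matrix.mul_apply, conjTranspose_apply] at h1
    simp only [A, B, Matrix.mul_apply, conjTranspose_apply, of_apply, Fintype.sum_prod_type]
    rw [show (∑ o, ∑ w, star (V' (upd i o p) w) * V' (upd i' o p') w) = _ from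
      (Finset.sum_congr rfl fun o _ => Finset.sum_congr rfl fun w _ => mul_comm _ _).trans h1]
    rw [Finset.sum_eq_single i']
    · by_cases hi : i' = i
      · simp [hi, mul_comm]
      · simp [hi]
    · intro b _ hb
      simp [hb]
    · simp
  obtain ⟨T, hT, hTA⟩ := exists_isometry_mul_eq hAB (by simpa using hc)
  refine ⟨T, hT, fun i o p w' => ?_⟩
  have h2 := congrFun (congrFun hTA (o, w')) (i, p)
  simp only [Matrix.mul_apply, A, B, of_apply, Fintype.sum_prod_type] at h2
  rw [← h2, Finset.sum_eq_single i]
  · simp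
  · intro b _ hb
    simp [hb]
  · simp

end Realization

/-! ### Causality: amplitudes depend only on messages already exchanged. -/

section Amplitudes

variable {r : ℕ} {X : Fin (r + 1) → Type*} {Y : Fin r → Type*}
  [∀ k, Fintype (X k)] [∀ k, DecidableEq (X k)]
  [∀ k, Fintype (Y k)] [∀ k, DecidableEq (Y k)]

theorem PureStrategy.amplitude_succ (A : PureStrategy X Y) (y : OutIdx Y) (x : InIdx X)
    (k : Fin r) (z' : Fin (A.mem k.succ)) :
    A.amplitude y x k.succ z' =
      ∑ z, A.A k (y k, z') (x k, z) * A.amplitude y x k.castSucc z := rfl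

theorem PureCoStrategy.amplitude_succ (B : PureCoStrategy X Y) (x : ∀ k, X k) (y : OutIdx Y)
    (k : Fin r) (w' : Fin (B.mem k.succ)) :
    B.amplitude x y k.succ w' =
      ∑ w, B.B k (x k.succ, w') (y k, w) * B.amplitude x y k.castSucc w := rfl

theorem PureStrategy.amplitude_congr (A : PureStrategy X Y) {y y' : OutIdx Y} {x x' : InIdx X}
    (k : Fin (r + 1)) (hy : ∀ j : Fin r, j.castSucc < k → y j = y' j)
    (hx : ∀ j : Fin r, j.castSucc < k → x j = x' j) :
    A.amplitude y x k = A.amplitude y' x' k := by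
  induction k using Fin.induction with
  | zero => rfl
  | succ k ih =>
    ext z'
    rw [A.amplitude_succ, A.amplitude_succ, hy k k.castSucc_lt_succ, hx k k.castSucc_lt_succ,
      ih (fun j hj => hy j (hj.trans k.castSucc_lt_succ))
        (fun j hj => hx j (hj.trans k.castSucc_lt_succ))]

theorem PureCoStrategy.amplitude_congr (B : PureCoStrategy X Y) {x x' : ∀ k, X k}
    {y y' : OutIdx Y} (k : Fin (r + 1)) (hx : ∀ j, j ≤ k → x j = x' j)
    (hy : ∀ j : Fin r, j.castSucc < k → y j = y' j) :
    B.amplitude x y k = B.amplitude x' y' k := by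
  induction k using Fin.induction with
  | zero =>
    ext w
    change B.β (x 0, w) = B.β (x' 0, w)
    rw [hx 0 le_rfl]
  | succ k ih =>
    ext w'
    rw [B.amplitude_succ, B.amplitude_succ, hy k k.castSucc_lt_succ, hx k.succ le_rfl,
      ih (fun j hj => hx j (hj.trans k.castSucc_lt_succ.le))
        (fun j hj => hy j (hj.trans k.castSucc_lt_succ))]

theorem PureStrategy.amplitude_update (A : PureStrategy X Y) (y : OutIdx Y) (x : InIdx X)
    (k : Fin r) (b : Y k) (a : X k.castSucc) :
    A.amplitude (Function.update y k b) (Function.update x k a) k.castSucc =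
      A.amplitude y x k.castSucc := by
  refine A.amplitude_congr _ (fun j hj => ?_) (fun j hj => ?_) <;>
  · have : j ≠ k := by rintro rfl; exact lt_irrefl _ hj
    simp [this]

theorem PureCoStrategy.amplitude_update (B : PureCoStrategy X Y) (x : ∀ k, X k) (y : OutIdx Y)
    (k : Fin r) (a : X k.succ) (b : Y k) :
    B.amplitude (Function.update x k.succ a) (Function.update y k b) k.castSucc =
      B.amplitude x y k.castSucc := by
  refine B.amplitude_congr _ (fun j hj => ?_) (fun j hj => ?_)
  · have : j ≠ k.succ := by rintro rfl; exact absurd hj (not_le.2 k.castSucc_lt_succ)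
    simp [this]
  · have : j ≠ k := by rintro rfl; exact lt_irrefl _ hj
    simp [this]

end Amplitudes

/-! ### Pure strategies and co-strategies versus families of Gram matrices. -/

section Grams

open Matrix

variable {r : ℕ} (X : Fin (r + 1) → Type*) (Y : Fin r → Type*)
  [∀ k, Fintype (X k)] [∀ k, DecidableEq (X k)]
  [∀ k, Fintype (Y k)] [∀ k, DecidableEq (Y k)]

/-- Basis of `(X_0 ⊗ ⋯ ⊗ X_r) ⊗ (Y_1 ⊗ ⋯ ⊗ Y_r)`. -/
abbrev FullIdx := (∀ k, X k) × OutIdx Y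

variable {X Y}

/-- Replace the `k`-th message pair of a co-strategy. -/
def FullIdx.upd (k : Fin r) (b : Y k) (a : X k.succ) (p : FullIdx X Y) : FullIdx X Y :=
  (Function.update p.1 k.succ a, Function.update p.2 k b)

/-- Replace the `k`-th message pair of a strategy. -/
def updPair (k : Fin r) (a : X k.castSucc) (b : Y k) (p : OutIdx Y × InIdx X) :
    OutIdx Y × InIdx X :=
  (Function.update p.1 k b, Function.update p.2 k a)

variable (X Y) in
/-- Families of Gram matrices of the amplitudes of pure strategies. -/
structure StrategyGram (R : Fin (r + 1) →
    Matrix (OutIdx Y × InIdx X) (OutIdx Y × InIdx X) ℂ) : Prop where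
  posSemidef : ∀ k, (R k).PosSemidef
  zero : ∀ p q, R 0 p q = 1
  succ : ∀ (k : Fin r) a a' p p', ∑ b, R k.succ (updPair k a b p) (updPair k a' b p') =
    if a = a' then R k.castSucc p p' else 0

variable (X Y) in
/-- Families of Gram matrices of the amplitudes of pure co-strategies. -/
structure CoStrategyGram (R : Fin (r + 1) → Matrix (FullIdx X Y) (FullIdx X Y) ℂ) :
    Prop where
  posSemidef : ∀ k, (R k).PosSemidef
  zero : ∀ p p' : FullIdx X Y, p.1 0 = p'.1 0 → ∀ q, R 0 p q = R 0 p' q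
  trace_zero : ∀ p : FullIdx X Y,
    ∑ a, R 0 (Function.update p.1 0 a, p.2) (Function.update p.1 0 a, p.2) = 1
  succ : ∀ (k : Fin r) b b' p p',
    ∑ a, R k.succ (FullIdx.upd k b a p) (FullIdx.upd k b' a p') =
      if b = b' then R k.castSucc p p' else 0

/-- Summing over the outputs contracts `Tᴴ * T = 1`. This is the converse of `exists_isometry_step`:
isometric rounds force the recursion between successive Gram matrices. -/
theorem sum_isometry_mul {P I O m m' : Type*} [Fintype I] [Fintype O] [Fintype m]
    [Fintype m'] [DecidableEq I] [DecidableEq m] {T : Matrix (O × m') (I × m) ℂ}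
    (hT : IsIsometry T) (V : Matrix P m ℂ) (i i' : I) (p p' : P) :
    ∑ o, ∑ w', (∑ w, T (o, w') (i, w) * V p w) * star (∑ w, T (o, w') (i', w) * V p' w) =
      if i = i' then (V * Vᴴ) p p' else 0 := by
  have hT' : ∀ a b, ∑ o, ∑ w', star (T (o, w') a) * T (o, w') b = if a = b then 1 else 0 :=
    fun a b => by
      rw [← Matrix.one_apply, ← show Tᴴ * T = 1 from hT]
      simp [Matrix.mul_apply, Fintype.sum_prod_type]
  calc _ = ∑ o, ∑ w', ∑ w, ∑ v, (star (T (o, w') (i', v)) * T (o, w') (i, w)) *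
          (V p w * star (V p' v)) := by
        simp only [star_sum, star_mul', Finset.sum_mul_sum]
        refine Finset.sum_congr rfl fun o _ => Finset.sum_congr rfl fun w' _ =>
          Finset.sum_congr rfl fun w _ => Finset.sum_congr rfl fun v _ => by ring
    _ = ∑ w, ∑ v, (∑ o, ∑ w', star (T (o, w') (i', v)) * T (o, w') (i, w)) *
          (V p w * star (V p' v)) := by
        simp only [Finset.sum_mul]
        rw [Finset.sum_congr rfl fun o _ => Finset.sum_comm]
        rw [Finset.sum_comm]
        refine Finset.sum_congr rfl fun w _ => ?_
        rw [Finset.sum_congr rfl fun o _ => Finset.sum_comm]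
        rw [Finset.sum_comm]
    _ = _ := by
        simp only [hT', Prod.mk.injEq]
        by_cases h : i = i'
        · simp [h, Matrix.mul_apply]
        · simp [h, Ne.symm h]

theorem PureStrategy.strategyGram (A : PureStrategy X Y) : StrategyGram X Y fun k =>
    (Matrix.of fun p z => A.amplitude p.1 p.2 k z) *
      (Matrix.of fun p z => A.amplitude p.1 p.2 k z)ᴴ where
  posSemidef k := posSemidef_self_mul_conjTranspose _
  zero p q := by
    have h : ∀ p : OutIdx Y × InIdx X, ∀ z, A.amplitude p.1 p.2 0 z = 1 := fun _ _ => rfl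
    simp [Matrix.mul_apply, h, A.mem_zero]
  succ k a a' p p' := by
    rw [← sum_isometry_mul (A.isometry k)]
    simp only [Matrix.mul_apply, of_apply, conjTranspose_apply]
    refine Finset.sum_congr rfl fun b _ => Finset.sum_congr rfl fun z' _ => ?_
    rw [A.amplitude_succ, A.amplitude_succ]
    simp [updPair, A.amplitude_update]

theorem PureCoStrategy.coStrategyGram (B : PureCoStrategy X Y) : CoStrategyGram X Y fun k =>
    (Matrix.of fun p w => B.amplitude p.1 p.2 k w) *
      (Matrix.of fun p w => B.amplitude p.1 p.2 k w)ᴴ where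
  posSemidef k := posSemidef_self_mul_conjTranspose _
  zero p p' h q := by
    have e : ∀ p : FullIdx X Y, ∀ w, B.amplitude p.1 p.2 0 w = B.β (p.1 0, w) := fun _ _ => rfl
    simp [Matrix.mul_apply, e, h]
  trace_zero p := by
    have e : ∀ x y w, B.amplitude x y 0 w = B.β (x 0, w) := fun _ _ _ => rfl
    simp only [Matrix.mul_apply, of_apply, conjTranspose_apply, e, Function.update_self,
      RCLike.star_def, Complex.mul_conj']
    have h := B.norm_β
    rw [Fintype.sum_prod_type] at h
    exact_mod_cast h
  succ k b b' p p' := by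
    rw [← sum_isometry_mul (B.isometry k)]
    simp only [Matrix.mul_apply, of_apply, conjTranspose_apply]
    refine Finset.sum_congr rfl fun a _ => Finset.sum_congr rfl fun z' _ => ?_
    rw [B.amplitude_succ, B.amplitude_succ]
    simp [FullIdx.upd, B.amplitude_update]

/-- Factor each `R k` as `V k * (V k)ᴴ`. The recursion supplies an isometry carrying the rows of one
factor to those of the next, and induction identifies these rows with the amplitudes. -/
theorem StrategyGram.exists_pureStrategy [∀ k, Nonempty (X k)] [∀ k, Nonempty (Y k)]
    {R : Fin (r + 1) → Matrix (OutIdx Y × InIdx X) (OutIdx Y × InIdx X) ℂ}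
    (hR : StrategyGram X Y R) : ∃ A : PureStrategy X Y, ∀ k,
      (Matrix.of fun p z => A.amplitude p.1 p.2 k z) *
        (Matrix.of fun p z => A.amplitude p.1 p.2 k z)ᴴ = R k := by
  let c := Fintype.card (OutIdx Y × InIdx X)
  let q := Fintype.card (InIdx X)
  have hc : 0 < c := Fintype.card_pos
  have hq : 0 < q := Fintype.card_pos
  -- Dimension `c` suffices to factor `R k`; a factor `q` per round leaves room for the isometry,
  -- since each input space has dimension at most `q`. The initial memory must be one-dimensional.
  let D : Fin (r + 1) → ℕ := fun k => if k = 0 then 1 else c * q ^ (k : ℕ)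
  have hD : ∀ k, D k ≤ c * q ^ (k : ℕ) := fun k => by
    dsimp only [D]
    split_ifs
    · exact Nat.succ_le_of_lt (by positivity)
    · exact le_rfl
  have hV : ∀ k, ∃ V : Matrix (OutIdx Y × InIdx X) (Fin (D k)) ℂ, V * Vᴴ = R k ∧
      (k = 0 → ∀ p z, V p z = 1) := fun k => by
    by_cases hk : k = 0
    · subst hk
      refine ⟨Matrix.of fun _ _ => 1, ?_, fun _ _ _ => rfl⟩
      ext p p'
      rw [Matrix.mul_apply, hR.zero]
      simp only [of_apply, conjTranspose_apply, star_one, mul_one, Finset.sum_const,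
        Finset.card_univ, Fintype.card_fin]
      simp [D]
    · obtain ⟨V, hV⟩ := PosSemidef.exists_eq_mul_conjTranspose (n := Fin (D k))
        (hR.posSemidef k) (by
          simp only [D, hk, if_false, Fintype.card_fin]
          exact Nat.le_mul_of_pos_right _ (by positivity))
      exact ⟨V, hV, fun h => absurd h hk⟩
  choose V hV hV0 using hV
  have hT : ∀ k : Fin r, ∃ T : Matrix (Y k × Fin (D k.succ)) (X k.castSucc × Fin (D k.castSucc)) ℂ,
      IsIsometry T ∧ ∀ a b p z', ∑ z, T (b, z') (a, z) * V k.castSucc p z =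
        V k.succ (updPair k a b p) z' := fun k => by
    refine exists_isometry_step _ _ (updPair k) (fun a a' p p' => ?_) ?_
    · rw [hV, hV]
      exact hR.succ k a a' p p'
    · simp only [Fintype.card_fin]
      have h1 : Fintype.card (X k.castSucc) ≤ q :=
        Fintype.card_le_of_surjective (fun x : InIdx X => x k) (Function.surjective_eval k)
      have h2 : 0 < Fintype.card (Y k) := Fintype.card_pos
      calc Fintype.card (X k.castSucc) * D k.castSucc
          ≤ q * (c * q ^ (k : ℕ)) := Nat.mul_le_mul h1 (hD k.castSucc)
        _ = D k.succ := by
          simp only [D, Fin.succ_ne_zero, if_false, Fin.val_succ]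
          ring
        _ ≤ _ := Nat.le_mul_of_pos_left _ h2
  choose T hTi hT using hT
  refine ⟨⟨D, by simp [D], T, hTi⟩, fun k => ?_⟩
  rw [← hV k]
  have key : ∀ p : OutIdx Y × InIdx X, PureStrategy.amplitude ⟨D, by simp [D], T, hTi⟩ p.1 p.2 k =
      V k p := fun p => by
    induction k using Fin.induction with
    | zero =>
      ext z
      rw [hV0 0 rfl]
      rfl
    | succ k ih =>
      ext z'
      rw [PureStrategy.amplitude_succ, ih]
      change ∑ z, T k (p.1 k, z') (p.2 k, z) * V k.castSucc p z = _
      rw [hT]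
      simp [updPair]
  have key' : (Matrix.of fun p z => PureStrategy.amplitude (X := X) (Y := Y)
      ⟨D, by simp [D], T, hTi⟩ p.1 p.2 k z) = V k := by
    ext p z
    exact congrFun (key p) z
  rw [key']

theorem CoStrategyGram.exists_pureCoStrategy [∀ k, Nonempty (X k)] [∀ k, Nonempty (Y k)]
    {R : Fin (r + 1) → Matrix (FullIdx X Y) (FullIdx X Y) ℂ}
    (hR : CoStrategyGram X Y R) : ∃ B : PureCoStrategy X Y, ∀ k,
      (Matrix.of fun p w => B.amplitude p.1 p.2 k w) *
        (Matrix.of fun p w => B.amplitude p.1 p.2 k w)ᴴ = R k := by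
  let c := Fintype.card (FullIdx X Y)
  let q := Fintype.card (OutIdx Y)
  have hc : 0 < c := Fintype.card_pos
  have hq : 0 < q := Fintype.card_pos
  let D : Fin (r + 1) → ℕ := fun k => c * q ^ (k : ℕ)
  choose V hV using fun k => PosSemidef.exists_eq_mul_conjTranspose (n := Fin (D k))
    (hR.posSemidef k) (by
      simp only [D, Fintype.card_fin]
      exact Nat.le_mul_of_pos_right _ (by positivity))
  have hT : ∀ k : Fin r, ∃ T : Matrix (X k.succ × Fin (D k.succ)) (Y k × Fin (D k.castSucc)) ℂ,
      IsIsometry T ∧ ∀ b a p w', ∑ w, T (a, w') (b, w) * V k.castSucc p w =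
        V k.succ (FullIdx.upd k b a p) w' := fun k => by
    refine exists_isometry_step _ _ (FullIdx.upd k) (fun a a' p p' => ?_) ?_
    · rw [hV, hV]
      exact hR.succ k a a' p p'
    · simp only [Fintype.card_fin]
      have h1 : Fintype.card (Y k) ≤ q :=
        Fintype.card_le_of_surjective (fun y : OutIdx Y => y k) (Function.surjective_eval k)
      have h2 : 0 < Fintype.card (X k.succ) := Fintype.card_pos
      calc Fintype.card (Y k) * D k.castSucc
          ≤ q * (c * q ^ (k : ℕ)) := Nat.mul_le_mul h1 le_rfl
        _ = D k.succ := by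
          simp only [D, Fin.val_succ]
          ring
        _ ≤ _ := Nat.le_mul_of_pos_left _ h2
  choose T hTi hT using hT
  let p₀ : FullIdx X Y := Classical.arbitrary _
  -- The rows of `V 0` depend only on the first message, by `CoStrategyGram.zero`, so the other
  -- coordinates may be frozen at those of `p₀`.
  let β : X 0 × Fin (D 0) → ℂ := fun s => V 0 (Function.update p₀.1 0 s.1, p₀.2) s.2
  have hβ : ∑ s, ‖β s‖ ^ 2 = 1 := by
    have h := hR.trace_zero p₀
    rw [← hV] at h
    simp only [Matrix.mul_apply, conjTranspose_apply, RCLike.star_def, Complex.mul_conj'] at h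
    rw [Fintype.sum_prod_type]
    exact_mod_cast h
  refine ⟨⟨D, β, hβ, T, hTi⟩, fun k => ?_⟩
  rw [← hV k]
  have key : ∀ p : FullIdx X Y, PureCoStrategy.amplitude ⟨D, β, hβ, T, hTi⟩ p.1 p.2 k =
      V k p := fun p => by
    induction k using Fin.induction with
    | zero =>
      have h : V 0 (Function.update p₀.1 0 (p.1 0), p₀.2) = V 0 p := by
        apply row_eq_of_mul_conjTranspose_row_eq
        rw [hV]
        ext q
        exact hR.zero _ _ (by simp) q
      exact h
    | succ k ih =>
      ext z'
      rw [PureCoStrategy.amplitude_succ, ih]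
      change ∑ z, T k (p.1 k.succ, z') (p.2 k, z) * V k.castSucc p z = _
      rw [hT]
      simp [FullIdx.upd]
  have key' : (Matrix.of fun p z => PureCoStrategy.amplitude (X := X) (Y := Y)
      ⟨D, β, hβ, T, hTi⟩ p.1 p.2 k z) = V k := by
    ext p z
    exact congrFun (key p) z
  rw [key']

end Grams
-- The final state as a sum over message histories.
section FinalState

open Matrix

/-- Swapping `a` with the `i`-th value of `f` is an involution, after which the summand no longer
involves the second variable. -/
theorem sum_sum_update {ι : Type*} [Fintype ι] [DecidableEq ι] {α : ι → Type*}
    [∀ i, Fintype (α i)] (i : ι) (g : (∀ j, α j) → ℂ) :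
    ∑ f, ∑ a, g (Function.update f i a) = Fintype.card (α i) * ∑ f, g f := by
  have hinv : Function.Involutive fun s : (∀ j, α j) × α i => (Function.update s.1 i s.2, s.1 i) :=
    fun s => by simp
  rw [← Fintype.sum_prod_type' (f := fun f a => g (Function.update f i a))]
  rw [show (∑ s : (∀ j, α j) × α i, g (Function.update s.1 i s.2)) =
    ∑ s : (∀ j, α j) × α i, g s.1 from
    Equiv.sum_comp hinv.toPerm fun s : (∀ j, α j) × α i => g s.1]
  simp [Fintype.sum_prod_type_right]

theorem prod_ite_le_succ {r : ℕ} {M : Type*} [CommMonoid M] (f : Fin (r + 1) → M) (k : Fin r) :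
    (∏ j, if j ≤ k.succ then f j else 1) = (∏ j, if j ≤ k.castSucc then f j else 1) * f k.succ := by
  have h : ∀ j, (if j ≤ k.succ then f j else 1) =
      (if j ≤ k.castSucc then f j else 1) * if j = k.succ then f j else 1 := fun j => by
    rcases lt_trichotomy j k.succ with hj | rfl | hj
    · simp [hj.le, hj.ne, Fin.le_castSucc_iff.2 hj]
    · simp
    · simp [hj.not_ge, hj.ne', (k.castSucc_lt_succ.trans hj).not_ge]
  rw [Finset.prod_congr rfl fun j _ => h j, Finset.prod_mul_distrib, Finset.prod_ite_eq',
    if_pos (Finset.mem_univ _)]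

theorem prod_ite_castSucc_lt_succ {r : ℕ} {M : Type*} [CommMonoid M] (f : Fin r → M) (k : Fin r) :
    (∏ j : Fin r, if j.castSucc < k.succ then f j else 1) =
      (∏ j : Fin r, if j.castSucc < k.castSucc then f j else 1) * f k := by
  have h : ∀ j : Fin r, (if j.castSucc < k.succ then f j else 1) =
      (if j.castSucc < k.castSucc then f j else 1) * if j = k then f j else 1 := fun j => by
    rcases lt_trichotomy j k with hj | rfl | hj
    · have := Fin.castSucc_lt_castSucc_iff.2 hj
      simp [hj, hj.ne, this.trans k.castSucc_lt_succ]
    · simp [j.castSucc_lt_succ]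
    · have : ¬ j.castSucc < k.succ := by
        rw [Fin.castSucc_lt_succ_iff]; exact hj.not_ge
      simp [hj.not_gt, hj.ne', this]
  rw [Finset.prod_congr rfl fun j _ => h j, Finset.prod_mul_distrib, Finset.prod_ite_eq',
    if_pos (Finset.mem_univ _)]

variable {r : ℕ} {X : Fin (r + 1) → Type*} {Y : Fin r → Type*}
  [∀ k, Fintype (X k)] [∀ k, DecidableEq (X k)]
  [∀ k, Fintype (Y k)] [∀ k, DecidableEq (Y k)]

theorem stateAfter_succ (A : PureStrategy X Y) (B : PureCoStrategy X Y) (k : Fin r)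
    (x' : X k.succ) (z' : Fin (A.mem k.succ)) (w' : Fin (B.mem k.succ)) :
    stateAfter A B k.succ x' z' w' = ∑ y, ∑ w, B.B k (x', w') (y, w) *
      ∑ x, ∑ z, A.A k (y, z') (x, z) * stateAfter A B k.castSucc x z w := rfl

/-- The state after `k` rounds sums over histories so far. Summing over complete histories instead
counts each of these once per continuation; the cardinalities compensate for this without any
division. -/
theorem stateAfter_eq_sum (A : PureStrategy X Y) (B : PureCoStrategy X Y) (k : Fin (r + 1))
    (x : X k) (z : Fin (A.mem k)) (w : Fin (B.mem k)) :
    (Fintype.card (∀ k, X k) * Fintype.card (OutIdx Y) : ℂ) * stateAfter A B k x z w =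
      ((∏ j, if j ≤ k then (Fintype.card (X j) : ℂ) else 1) *
        ∏ j : Fin r, if j.castSucc < k then (Fintype.card (Y j) : ℂ) else 1) *
      ∑ a : ∀ k, X k, ∑ b, if a k = x then
        A.amplitude b (fun j => a j.castSucc) k z * B.amplitude a b k w else 0 := by
  induction k using Fin.induction with
  | zero =>
    have e1 : ∀ a b, (if a 0 = x then A.amplitude b (fun j => a j.castSucc) 0 z *
        B.amplitude a b 0 w else 0) = if a 0 = x then B.β (x, w) else 0 := fun a b => by
      split_ifs with h
      · change (1 : ℂ) * B.β (a 0, w) = _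
        rw [one_mul, h]
      · rfl
    have e2 := sum_sum_update (α := X) 0 fun a => if a 0 = x then B.β (x, w) else 0
    simp only [Function.update_self, Finset.sum_ite_eq', Finset.mem_univ, if_true,
      Finset.sum_const, Finset.card_univ, nsmul_eq_mul] at e2
    simp only [e1, Finset.sum_const, Finset.card_univ, nsmul_eq_mul, ← Finset.mul_sum,
      Fin.not_lt_zero, if_false, Finset.prod_const_one, mul_one, nonpos_iff_eq_zero,
      Finset.prod_ite_eq', Finset.mem_univ, if_true]
    change _ * B.β (x, w) = _
    linear_combination (Fintype.card (OutIdx Y) : ℂ) * e2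
  | succ k ih =>
    rw [prod_ite_le_succ, prod_ite_castSucc_lt_succ]
    set κ := (∏ j, if j ≤ k.castSucc then (Fintype.card (X j) : ℂ) else 1) *
        ∏ j : Fin r, if j.castSucc < k.castSucc then (Fintype.card (Y j) : ℂ) else 1 with hκ
    -- Both messages that round `k` produces are overwritten by fresh variables: the condition fixes
    -- the first at `x`, and the second becomes the sum over `y`.
    have e1 : (Fintype.card (X k.succ) * Fintype.card (Y k) : ℂ) *
        (∑ a : ∀ k, X k, ∑ b, if a k.succ = x then
          A.amplitude b (fun j => a j.castSucc) k.succ z * B.amplitude a b k.succ w else 0) =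
        ∑ a : ∀ k, X k, ∑ b, ∑ y,
          (∑ z', A.A k (y, z) (a k.castSucc, z') *
            A.amplitude b (fun j => a j.castSucc) k.castSucc z') *
          ∑ w', B.B k (x, w) (y, w') * B.amplitude a b k.castSucc w' := by
      rw [mul_assoc, mul_left_comm, ← sum_sum_update k.succ, Finset.mul_sum]
      refine Finset.sum_congr rfl fun a _ => ?_
      simp only [Function.update_self]
      rw [Finset.sum_comm, ← sum_sum_update k]
      refine Finset.sum_congr rfl fun b _ => Finset.sum_congr rfl fun y _ => ?_
      rw [Finset.sum_ite_eq' Finset.univ x, if_pos (Finset.mem_univ _)]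
      have hk : Function.update a k.succ x k.castSucc = a k.castSucc := by
        rw [Function.update_of_ne k.castSucc_lt_succ.ne]
      rw [A.amplitude_succ, B.amplitude_succ]
      simp only [Function.update_self, hk, B.amplitude_update]
      congr 1
      refine Finset.sum_congr rfl fun z' _ => ?_
      refine congrArg _ (congrFun (A.amplitude_congr _ (fun j hj => ?_) (fun j hj => ?_)) z')
      · have : j ≠ k := by rintro rfl; exact lt_irrefl _ hj
        simp [this]
      · rw [Function.update_of_ne (hj.trans k.castSucc_lt_succ).ne]
    have e2 : ∀ (x' : X k.castSucc) z' w',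
        (Fintype.card (∀ k, X k) * Fintype.card (OutIdx Y) : ℂ) *
          stateAfter A B k.castSucc x' z' w' = _ := fun x' z' w' => ih x' z' w'
    calc _ = ∑ y, ∑ w', B.B k (x, w) (y, w') * ∑ x', ∑ z', A.A k (y, z) (x', z') *
          ((Fintype.card (∀ k, X k) * Fintype.card (OutIdx Y) : ℂ) *
            stateAfter A B k.castSucc x' z' w') := by
          rw [stateAfter_succ]
          simp only [Finset.mul_sum]
          refine Finset.sum_congr rfl fun _ _ => Finset.sum_congr rfl fun _ _ =>
            Finset.sum_congr rfl fun _ _ => Finset.sum_congr rfl fun _ _ => by ring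
      _ = κ * ∑ a : ∀ k, X k, ∑ b, ∑ y,
          (∑ z', A.A k (y, z) (a k.castSucc, z') *
            A.amplitude b (fun j => a j.castSucc) k.castSucc z') *
          ∑ w', B.B k (x, w) (y, w') * B.amplitude a b k.castSucc w' := by
          have e3 : ∀ y w', ∑ x', ∑ z', A.A k (y, z) (x', z') *
              ((Fintype.card (∀ k, X k) * Fintype.card (OutIdx Y) : ℂ) *
                stateAfter A B k.castSucc x' z' w') =
              κ * ∑ a : ∀ k, X k, ∑ b, (∑ z', A.A k (y, z) (a k.castSucc, z') *
                A.amplitude b (fun j => a j.castSucc) k.castSucc z') *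
                  B.amplitude a b k.castSucc w' := fun y w' => by
            simp only [e2, Finset.mul_sum, Finset.sum_mul]
            rw [Finset.sum_congr rfl fun x' _ => Finset.sum_comm]
            rw [Finset.sum_comm]
            refine Finset.sum_congr rfl fun a _ => ?_
            rw [Finset.sum_congr rfl fun x' _ => Finset.sum_comm]
            rw [Finset.sum_comm]
            refine Finset.sum_congr rfl fun b _ => ?_
            rw [Finset.sum_comm]
            refine Finset.sum_congr rfl fun z' _ => ?_
            rw [Finset.sum_eq_single (a k.castSucc)]
            · rw [if_pos rfl]
              ring
            · intro x' _ hx'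
              rw [if_neg hx'.symm]
              ring
            · simp
          simp only [e3]
          simp only [Finset.mul_sum]
          rw [Finset.sum_congr rfl fun y _ => Finset.sum_comm]
          rw [Finset.sum_comm]
          refine Finset.sum_congr rfl fun a _ => ?_
          rw [Finset.sum_congr rfl fun y _ => Finset.sum_comm]
          rw [Finset.sum_comm]
          refine Finset.sum_congr rfl fun b _ => Finset.sum_congr rfl fun y _ =>
            Finset.sum_congr rfl fun w' _ => by ring
      _ = _ := by
          rw [← e1]
          ring

theorem sum_mul_star_of_isIsometry {a b w : Type*} [Fintype a] [Fintype b] [Fintype w]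
    [DecidableEq a] {T : Matrix b a ℂ} (hT : IsIsometry T) (ψ : a → w → ℂ) :
    ∑ j, ∑ w, (∑ i, T j i * ψ i w) * star (∑ i, T j i * ψ i w) =
      ∑ i, ∑ w, ψ i w * star (ψ i w) := by
  have h : ((T * Matrix.of ψ)ᴴ * (T * Matrix.of ψ)).trace =
      ((Matrix.of ψ)ᴴ * Matrix.of ψ).trace := by
    rw [conjTranspose_mul, Matrix.mul_assoc, ← Matrix.mul_assoc Tᴴ, show Tᴴ * T = 1 from hT,
      Matrix.one_mul]
  simp only [trace, diag_apply, Matrix.mul_apply, conjTranspose_apply, of_apply] at h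
  rw [Finset.sum_comm, Finset.sum_comm (γ := a)]
  simpa only [mul_comm] using h

/-- Each half-round acts isometrically on part of the system, so the norm of the initial state is
preserved. -/
theorem sum_stateAfter (A : PureStrategy X Y) (B : PureCoStrategy X Y) (k : Fin (r + 1)) :
    ∑ x, ∑ z, ∑ w, stateAfter A B k x z w * star (stateAfter A B k x z w) = 1 := by
  induction k using Fin.induction with
  | zero =>
    have h : ∀ x z w, stateAfter A B 0 x z w = B.β (x, w) := fun _ _ _ => rfl
    have hβ := B.norm_β
    rw [Fintype.sum_prod_type] at hβ
    simp only [h, Finset.sum_const, Finset.card_univ, Fintype.card_fin, A.mem_zero, one_smul,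
      RCLike.star_def, Complex.mul_conj']
    exact_mod_cast hβ
  | succ k ih =>
    let φ : Y k → Fin (A.mem k.succ) → Fin (B.mem k.castSucc) → ℂ := fun y z' w =>
      ∑ x, ∑ z, A.A k (y, z') (x, z) * stateAfter A B k.castSucc x z w
    have h1 := sum_mul_star_of_isIsometry (A.isometry k)
      fun s w => stateAfter A B k.castSucc s.1 s.2 w
    have h2 := sum_mul_star_of_isIsometry (B.isometry k) fun s z' => φ s.1 z' s.2
    simp only [Fintype.sum_prod_type] at h1 h2
    rw [ih] at h1
    rw [← h1]
    simp only [stateAfter_succ]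
    rw [Finset.sum_congr rfl fun x _ => Finset.sum_comm, h2]
    exact Finset.sum_congr rfl fun y _ => Finset.sum_comm

end FinalState

/-! ### Strategies and co-strategies as operators; convexity and compactness. -/

section Operators

open Matrix

variable {r : ℕ} {X : Fin (r + 1) → Type*} {Y : Fin r → Type*}
  [∀ k, Fintype (X k)] [∀ k, DecidableEq (X k)] [Unique (X (Fin.last r))]
  [∀ k, Fintype (Y k)] [∀ k, DecidableEq (Y k)]

/-- The amplitudes of all runs of a pure strategy. -/
def PureStrategy.runMatrix (A : PureStrategy X Y) :
    Matrix (OutIdx Y × InIdx X) (Fin (A.mem (Fin.last r))) ℂ :=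
  Matrix.of fun p z => A.amplitude p.1 p.2 (Fin.last r) z

/-- The amplitudes of all runs of a pure co-strategy. -/
def PureCoStrategy.runMatrix (B : PureCoStrategy X Y) :
    Matrix (Fin (B.mem (Fin.last r))) (OutIdx Y × InIdx X) ℂ :=
  Matrix.of fun w p => B.amplitude (Fin.snoc (α := X) p.2 default) p.1 (Fin.last r) w

theorem PureStrategy.strategy_eq (A : PureStrategy X Y) :
    A.strategy = A.runMatrix * A.runMatrixᴴ := by
  ext p q
  simp [strategy, choi, channel, partialTraceRight, isometryMatrix, runMatrix, Matrix.mul_apply,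
    Matrix.single_apply, ite_and]

theorem PureCoStrategy.coStrategy_eq (B : PureCoStrategy X Y) :
    B.coStrategy = B.runMatrixᴴ * B.runMatrix := by
  ext p q
  simp [coStrategy, choi, adjointChannel, isometryMatrix, runMatrix, Matrix.mul_apply,
    Matrix.single_apply, Fintype.sum_prod_type, Matrix.one_apply, ite_and]

/-- After the last round the counting factors on both sides of `stateAfter_eq_sum` coincide and
cancel; the remaining sum over histories is a matrix product. -/
theorem finalState_eq [∀ k, Nonempty (X k)] [∀ k, Nonempty (Y k)] (A : PureStrategy X Y)
    (B : PureCoStrategy X Y) (z : Fin (A.mem (Fin.last r))) (w : Fin (B.mem (Fin.last r))) :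
    finalState A B z w = (B.runMatrix * A.runMatrix) w z := by
  have h := stateAfter_eq_sum A B (Fin.last r) default z w
  have h1 : ((∏ j, if j ≤ Fin.last r then (Fintype.card (X j) : ℂ) else 1) *
      ∏ j : Fin r, if j.castSucc < Fin.last r then (Fintype.card (Y j) : ℂ) else 1) =
      Fintype.card (∀ k, X k) * Fintype.card (OutIdx Y) := by
    simp [Fin.le_last, Fin.castSucc_lt_last, Fintype.card_pi]
  have h0 : (Fintype.card (∀ k, X k) * Fintype.card (OutIdx Y) : ℂ) ≠ 0 := by
    have := Fintype.card_ne_zero (α := ∀ k, X k)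
    have := Fintype.card_ne_zero (α := OutIdx Y)
    positivity
  rw [h1] at h
  rw [finalState, mul_left_cancel₀ h0 h]
  simp only [Matrix.mul_apply, PureStrategy.runMatrix, PureCoStrategy.runMatrix, of_apply,
    Fintype.sum_prod_type_right]
  refine Fintype.sum_equiv ⟨fun (a : ∀ k, X k) (j : Fin r) => a j.castSucc, fun x => Fin.snoc (α := X) x default,
    fun a => ?_, fun x => ?_⟩ _ _ fun a => ?_
  · ext j
    refine Fin.lastCases ?_ (fun j => ?_) j
    · exact Subsingleton.elim _ _
    · simp
  · ext j
    simp
  · refine Finset.sum_congr rfl fun b _ => ?_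
    have h2 : Fin.snoc (α := X) (fun j : Fin r => a j.castSucc) default = a := by
      ext j
      refine Fin.lastCases ?_ (fun j => ?_) j
      · exact Subsingleton.elim _ _
      · simp
    simp only [Equiv.coe_fn_mk, h2]
    rw [if_pos (Subsingleton.elim _ _), mul_comm]

theorem finalMix_eq [∀ k, Nonempty (X k)] [∀ k, Nonempty (Y k)] (A : PureStrategy X Y)
    (B : PureCoStrategy X Y) :
    finalMix A B = B.runMatrix * A.strategy * B.runMatrixᴴ := by
  rw [A.strategy_eq, ← Matrix.mul_assoc, Matrix.mul_assoc, ← conjTranspose_mul]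
  ext w w'
  rw [Matrix.mul_apply]
  simp only [finalMix, finalState_eq, of_apply, conjTranspose_apply]

theorem trace_finalMix (A : PureStrategy X Y) (B : PureCoStrategy X Y) :
    (finalMix A B).trace = 1 := by
  have h := sum_stateAfter A B (Fin.last r)
  rw [Fintype.sum_unique, Finset.sum_comm] at h
  exact h

/-- The run in which a pure co-strategy sends `p.2` and receives `p.1`. -/
def fullRun (p : OutIdx Y × InIdx X) : FullIdx X Y := (Fin.snoc (α := X) p.2 default, p.1)

/-- The co-strategy belonging to a family of Gram matrices. -/
def coStrategyOfGram (R : Fin (r + 1) → Matrix (FullIdx X Y) (FullIdx X Y) ℂ) : Op X Y :=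
  ((R (Fin.last r)).submatrix fullRun fullRun)ᵀ

/-- The transpose appears because `Nᴴ * N` conjugates the amplitude of its first index, whereas a
Gram matrix conjugates that of its second. -/
theorem PureCoStrategy.coStrategy_eq_coStrategyOfGram (B : PureCoStrategy X Y) :
    B.coStrategy = coStrategyOfGram fun k => (Matrix.of fun p w => B.amplitude p.1 p.2 k w) *
      (Matrix.of fun p w => B.amplitude p.1 p.2 k w)ᴴ := by
  rw [B.coStrategy_eq]
  ext p q
  simp [coStrategyOfGram, fullRun, runMatrix, Matrix.mul_apply, mul_comm]

/-- This trades memories of arbitrary size for conditions on matrices of fixed size. -/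
theorem isCoStrategy_iff [∀ k, Nonempty (X k)] [∀ k, Nonempty (Y k)] {C : Op X Y} :
    IsCoStrategy C ↔ ∃ R, CoStrategyGram X Y R ∧ coStrategyOfGram R = C := by
  constructor
  · rintro ⟨B, rfl⟩
    exact ⟨_, B.coStrategyGram, B.coStrategy_eq_coStrategyOfGram.symm⟩
  · rintro ⟨R, hR, rfl⟩
    obtain ⟨B, hB⟩ := hR.exists_pureCoStrategy
    refine ⟨B, ?_⟩
    rw [B.coStrategy_eq_coStrategyOfGram]
    congr 1
    exact funext hB

theorem isStrategy_iff [∀ k, Nonempty (X k)] [∀ k, Nonempty (Y k)] {S : Op X Y} :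
    IsStrategy S ↔ ∃ R, StrategyGram X Y R ∧ R (Fin.last r) = S := by
  constructor
  · rintro ⟨A, rfl⟩
    exact ⟨_, A.strategyGram, A.strategy_eq.symm⟩
  · rintro ⟨R, hR, rfl⟩
    obtain ⟨A, hA⟩ := hR.exists_pureStrategy
    exact ⟨A, A.strategy_eq.trans (hA _)⟩

/-- The Gram conditions are affine apart from positivity, which is convex. -/
theorem IsStrategy.convexCombination [∀ k, Nonempty (X k)] [∀ k, Nonempty (Y k)] {ι : Type*}
    [Fintype ι] {S : ι → Op X Y} {c : ι → ℝ} (hS : ∀ i, IsStrategy (S i)) (hc : ∀ i, 0 ≤ c i)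
    (hc1 : ∑ i, c i = 1) : IsStrategy (∑ i, (c i : ℂ) • S i) := by
  choose R hR hRS using fun i => isStrategy_iff.1 (hS i)
  refine isStrategy_iff.2 ⟨fun k => ∑ i, (c i : ℂ) • R i k, ⟨fun k => ?_, fun p q => ?_,
    fun k a a' p p' => ?_⟩, by simp only [hRS]⟩
  · exact posSemidef_sum _ fun i _ => ((hR i).posSemidef k).smul (by simpa using hc i)
  · simp only [Matrix.sum_apply, Matrix.smul_apply, (hR _).zero, smul_eq_mul, mul_one]
    exact_mod_cast hc1
  · simp only [Matrix.sum_apply, Matrix.smul_apply, smul_eq_mul]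
    rw [Finset.sum_comm]
    simp only [← Finset.mul_sum, (hR _).succ]
    split_ifs <;> simp

theorem norm_apply_le_one_of_diag_le_one {n : Type*} [Fintype n] [DecidableEq n]
    {M : Matrix n n ℂ} (hM : M.PosSemidef) (h : ∀ i, M i i ≤ 1) (i j : n) : ‖M i j‖ ≤ 1 := by
  obtain ⟨V, rfl⟩ := PosSemidef.exists_eq_mul_conjTranspose (n := n) hM le_rfl
  have hd : ∀ i, ∑ k, ‖V i k‖ ^ 2 ≤ 1 := fun i => by
    have := h i
    simp only [Matrix.mul_apply, conjTranspose_apply, RCLike.star_def, Complex.mul_conj'] at this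
    exact_mod_cast this
  rw [Matrix.mul_apply]
  calc ‖∑ k, V i k * Vᴴ k j‖ ≤ ∑ k, ‖V i k * Vᴴ k j‖ := norm_sum_le _ _
    _ ≤ ∑ k, (‖V i k‖ ^ 2 / 2 + ‖V j k‖ ^ 2 / 2) := Finset.sum_le_sum fun k _ => by
        rw [norm_mul, conjTranspose_apply, norm_star]
        linarith [two_mul_le_add_sq ‖V i k‖ ‖V j k‖]
    _ ≤ 1 := by
        rw [Finset.sum_add_distrib, ← Finset.sum_div, ← Finset.sum_div]
        linarith [hd i, hd j]

/-- On the diagonal the recursion writes an entry of `R k` as a sum of nonnegative entries of `R (k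
+ 1)`, so diagonal bounds pass forward from the normalization of `R 0`. -/
theorem CoStrategyGram.diag_le_one {R : Fin (r + 1) → Matrix (FullIdx X Y) (FullIdx X Y) ℂ}
    (hR : CoStrategyGram X Y R) (k : Fin (r + 1)) (p : FullIdx X Y) : R k p p ≤ 1 := by
  induction k using Fin.induction with
  | zero =>
    rw [← hR.trace_zero p]
    have h := Finset.single_le_sum (s := Finset.univ) (f := fun a : X 0 =>
      R 0 (Function.update p.1 0 a, p.2) (Function.update p.1 0 a, p.2))
      (fun _ _ => (hR.posSemidef 0).diag_nonneg) (Finset.mem_univ (p.1 0))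
    simpa using h
  | succ k ih =>
    refine le_trans ?_ ih
    have h1 := hR.succ k (p.2 k) (p.2 k) p p
    rw [if_pos rfl] at h1
    rw [← h1]
    have h := Finset.single_le_sum (s := Finset.univ) (f := fun a : X k.succ =>
      R k.succ (FullIdx.upd k (p.2 k) a p) (FullIdx.upd k (p.2 k) a p))
      (fun _ _ => (hR.posSemidef k.succ).diag_nonneg) (Finset.mem_univ (p.1 k.succ))
    simpa [FullIdx.upd] using h

theorem isClosed_posSemidef {n : Type*} [Fintype n] :
    IsClosed {M : Matrix n n ℂ | M.PosSemidef} := by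
  simp only [posSemidef_iff_dotProduct_mulVec, Set.ofPred_and, Set.ofPred_forall]
  refine IsClosed.inter (isClosed_eq (by fun_prop) (by fun_prop)) (isClosed_iInter fun x => ?_)
  exact isClosed_le continuous_const (by fun_prop)

theorem isCompact_coStrategyGram :
    IsCompact {R : Fin (r + 1) → Matrix (FullIdx X Y) (FullIdx X Y) ℂ |
      CoStrategyGram X Y R} := by
  have hK : IsCompact (Set.univ.pi fun _ => Set.univ.pi fun _ => Set.univ.pi fun _ =>
      Metric.closedBall 0 1 : Set (Fin (r + 1) → FullIdx X Y → FullIdx X Y → ℂ)) :=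
    isCompact_univ_pi fun _ => isCompact_univ_pi fun _ => isCompact_univ_pi fun _ =>
      isCompact_closedBall _ _
  refine hK.of_isClosed_subset (t := {R : Fin (r + 1) → FullIdx X Y → FullIdx X Y → ℂ |
    CoStrategyGram X Y R}) ?_ fun R hR k _ p _ q _ => ?_
  · have e : {R : Fin (r + 1) → Matrix (FullIdx X Y) (FullIdx X Y) ℂ | CoStrategyGram X Y R} =
        {R | ∀ k, (R k).PosSemidef} ∩
        ({R | ∀ p p' : FullIdx X Y, p.1 0 = p'.1 0 → ∀ q, R 0 p q = R 0 p' q} ∩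
        ({R | ∀ p : FullIdx X Y,
          ∑ a, R 0 (Function.update p.1 0 a, p.2) (Function.update p.1 0 a, p.2) = 1} ∩
        {R | ∀ (k : Fin r) b b' p p',
          ∑ a, R k.succ (FullIdx.upd k b a p) (FullIdx.upd k b' a p') =
            if b = b' then R k.castSucc p p' else 0})) := by
      ext R
      exact ⟨fun h => ⟨h.1, h.2, h.3, h.4⟩, fun h => ⟨h.1, h.2.1, h.2.2.1, h.2.2.2⟩⟩
    have hc : ∀ k p q, Continuous fun R : Fin (r + 1) → Matrix (FullIdx X Y) (FullIdx X Y) ℂ =>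
        R k p q := fun k p q => (continuous_apply k).matrix_elem p q
    change IsClosed {R : Fin (r + 1) → Matrix (FullIdx X Y) (FullIdx X Y) ℂ |
      CoStrategyGram X Y R}
    rw [e]
    refine IsClosed.inter ?_ (IsClosed.inter ?_ (IsClosed.inter ?_ ?_))
    · rw [Set.ofPred_forall]
      refine isClosed_iInter fun k => ?_
      have hk : Continuous fun R : Fin (r + 1) → Matrix (FullIdx X Y) (FullIdx X Y) ℂ => R k :=
        continuous_apply k
      exact isClosed_posSemidef.preimage hk
    · simp only [Set.ofPred_forall]
      exact isClosed_iInter fun p => isClosed_iInter fun p' => isClosed_iInter fun _ =>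
        isClosed_iInter fun q => isClosed_eq (hc _ _ _) (hc _ _ _)
    · simp only [Set.ofPred_forall]
      exact isClosed_iInter fun p =>
        isClosed_eq (continuous_finsetSum _ fun a _ => hc _ _ _) continuous_const
    · simp only [Set.ofPred_forall]
      refine isClosed_iInter fun k => isClosed_iInter fun b => isClosed_iInter fun b' =>
        isClosed_iInter fun p => isClosed_iInter fun p' =>
        isClosed_eq (continuous_finsetSum _ fun a _ => hc _ _ _) ?_
      split_ifs
      · exact hc _ _ _
      · exact continuous_const
  · rw [mem_closedBall_zero_iff]
    exact norm_apply_le_one_of_diag_le_one (hR.posSemidef k) (hR.diag_le_one k) p q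

theorem isCompact_isCoStrategy [∀ k, Nonempty (X k)] [∀ k, Nonempty (Y k)] :
    IsCompact {C : Op X Y | IsCoStrategy C} := by
  have e : {C : Op X Y | IsCoStrategy C} = coStrategyOfGram '' {R | CoStrategyGram X Y R} := by
    ext C
    exact isCoStrategy_iff
  rw [e]
  exact isCompact_coStrategyGram.image
    (((continuous_apply (Fin.last r)).matrix_submatrix _ _).matrix_transpose)

/-- The co-strategy sends uniformly random messages, whence `c = ∏ 1 / |X j|`. It makes the value
sets nonempty and the strategy norm faithful. -/
theorem exists_isCoStrategy_smul_one [∀ k, Nonempty (X k)] [∀ k, Nonempty (Y k)] :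
    ∃ c : ℝ, 0 < c ∧ IsCoStrategy ((c : ℂ) • (1 : Op X Y)) := by
  let p₀ : FullIdx X Y := Classical.arbitrary _
  let κ : Fin (r + 1) → ℝ := fun k => ∏ j, if j ≤ k then (Fintype.card (X j) : ℝ)⁻¹ else 1
  have hκ : ∀ k, 0 < κ k := fun k => Finset.prod_pos fun j _ => by
    have := Fintype.card_pos (α := X j)
    split_ifs <;> positivity
  -- Truncates a history to the messages exchanged so far, filling up from `p₀`; the Gram matrices
  -- are scaled indicators of equal truncations.
  let rep : Fin (r + 1) → FullIdx X Y → FullIdx X Y := fun k p =>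
    (fun j => if j ≤ k then p.1 j else p₀.1 j, fun j => if j.castSucc < k then p.2 j else p₀.2 j)
  have hrep : ∀ k p q, rep k p = rep k q ↔
      (∀ j, j ≤ k → p.1 j = q.1 j) ∧ ∀ j : Fin r, j.castSucc < k → p.2 j = q.2 j :=
    fun k p q => by
      simp only [rep, Prod.mk.injEq, funext_iff]
      refine and_congr (forall_congr' fun j => ?_) (forall_congr' fun j => ?_) <;>
      · split_ifs with h <;> simp [h]
  refine ⟨κ (Fin.last r), hκ _, isCoStrategy_iff.2
    ⟨fun k => (κ k : ℂ) • (1 : Matrix (FullIdx X Y) (FullIdx X Y) ℂ).submatrix (rep k) (rep k),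
      ⟨fun k => ?_, fun p p' h q => ?_, fun p => ?_, fun k b b' p p' => ?_⟩, ?_⟩⟩
  · exact (PosSemidef.one.submatrix _).smul (by simpa using (hκ k).le)
  · have : rep 0 p = rep 0 p' := by
      rw [hrep]
      refine ⟨fun j hj => ?_, fun j hj => absurd hj (Fin.not_lt_zero _)⟩
      rw [nonpos_iff_eq_zero.1 hj, h]
    change (κ 0 : ℂ) • (1 : Matrix (FullIdx X Y) (FullIdx X Y) ℂ) (rep 0 p) (rep 0 q) =
      (κ 0 : ℂ) • (1 : Matrix (FullIdx X Y) (FullIdx X Y) ℂ) (rep 0 p') (rep 0 q)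
    rw [this]
  · have : (Fintype.card (X 0) : ℂ) ≠ 0 := Nat.cast_ne_zero.2 Fintype.card_ne_zero
    simp [κ, this]
  · have h1 : ∀ a, rep k.succ (FullIdx.upd k b a p) = rep k.succ (FullIdx.upd k b' a p') ↔
        b = b' ∧ rep k.castSucc p = rep k.castSucc p' := fun a => by
      rw [hrep, hrep]
      constructor
      · rintro ⟨hx, hy⟩
        refine ⟨by simpa [FullIdx.upd] using hy k k.castSucc_lt_succ, fun j hj => ?_,
          fun j hj => ?_⟩
        · have hj' : j < k.succ := Fin.le_castSucc_iff.1 hj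
          simpa [FullIdx.upd, hj'.ne] using hx j hj'.le
        · have hj' : j ≠ k := by rintro rfl; exact lt_irrefl _ hj
          simpa [FullIdx.upd, hj'] using hy j (hj.trans k.castSucc_lt_succ)
      · rintro ⟨rfl, hx, hy⟩
        refine ⟨fun j hj => ?_, fun j hj => ?_⟩
        · rcases eq_or_lt_of_le hj with rfl | hj
          · simp [FullIdx.upd]
          · simpa [FullIdx.upd, hj.ne] using hx j (Fin.le_castSucc_iff.2 hj)
        · by_cases hjk : j = k
          · subst hjk
            simp [FullIdx.upd]
          · have : j.castSucc < k.castSucc := Fin.castSucc_lt_castSucc_iff.2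
              (lt_of_le_of_ne (Fin.castSucc_lt_succ_iff.1 hj) hjk)
            simpa [FullIdx.upd, hjk] using hy j this
    have h2 : (Fintype.card (X k.succ) : ℂ) * κ k.succ = κ k.castSucc := by
      have : (Fintype.card (X k.succ) : ℝ) ≠ 0 := Nat.cast_ne_zero.2 Fintype.card_ne_zero
      have h3 : (Fintype.card (X k.succ) : ℝ) * κ k.succ = κ k.castSucc := by
        simp only [κ, prod_ite_le_succ]
        field_simp
      exact_mod_cast h3
    simp only [Matrix.smul_apply, submatrix_apply, Matrix.one_apply, h1, smul_eq_mul, mul_ite,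
      mul_one, mul_zero, Finset.sum_const, Finset.card_univ, nsmul_eq_mul, h2, ite_and]
  · ext p q
    have h1 : rep (Fin.last r) (fullRun q) = rep (Fin.last r) (fullRun p) ↔ p = q := by
      rw [hrep]
      constructor
      · rintro ⟨hx, hy⟩
        refine Prod.ext (funext fun j => (hy j (Fin.castSucc_lt_last j)).symm) (funext fun j => ?_)
        simpa [fullRun] using (hx j.castSucc (Fin.le_last _)).symm
      · rintro rfl
        exact ⟨fun _ _ => rfl, fun _ _ => rfl⟩
    simp [coStrategyOfGram, Matrix.one_apply, h1]

end Operators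
-- Fidelity bounds for states from two-outcome measurements.
section Measurements

open Matrix

variable {n : Type*} [Fintype n] [DecidableEq n]

theorem sqrt_mul_add_sqrt_mul_le {p q : ℝ} (hp : 0 ≤ p) (hp1 : p ≤ 1) (hq : 0 ≤ q) (hq1 : q ≤ 1) :
    Real.sqrt (p * q) + Real.sqrt ((1 - p) * (1 - q)) ≤ Real.sqrt (1 - (p - q) ^ 2) := by
  apply Real.le_sqrt_of_sq_le
  have hp1' := sub_nonneg.2 hp1
  have hq1' := sub_nonneg.2 hq1
  rw [Real.sqrt_mul hp, Real.sqrt_mul hp1']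
  have a := Real.sq_sqrt hp
  have b := Real.sq_sqrt hq
  have c := Real.sq_sqrt hp1'
  have d := Real.sq_sqrt hq1'
  set x := Real.sqrt p
  set y := Real.sqrt q
  set z := Real.sqrt (1 - p)
  set t := Real.sqrt (1 - q)
  -- This pairing of the cross term makes the bound exactly `1 - (p - q)²`.
  have h1 := two_mul_le_add_sq (x * z) (y * t)
  have h2 : (x * y + z * t) ^ 2 ≤ x ^ 2 * y ^ 2 + z ^ 2 * t ^ 2 + (x ^ 2 * z ^ 2 + y ^ 2 * t ^ 2) := by
    nlinarith
  rw [a, b, c, d] at h2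
  linarith

theorem re_trace_mul_nonneg {A B : Matrix n n ℂ} (hA : A.PosSemidef) (hB : B.PosSemidef) :
    0 ≤ (A * B).trace.re :=
  (Complex.le_def.1 (PosSemidef.trace_mul_nonneg hA hB)).1

theorem re_trace_mul_add_of_add_eq_one {P E₀ E₁ : Matrix n n ℂ} (hP : P.trace = 1)
    (h : E₀ + E₁ = 1) : (E₀ * P).trace.re + (E₁ * P).trace.re = 1 := by
  rw [← Complex.add_re, ← trace_add, ← add_mul, h, Matrix.one_mul, hP, Complex.one_re]

theorem re_trace_sub_mul_sub (P Q E₀ E₁ : Matrix n n ℂ) :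
    ((E₀ - E₁) * (P - Q)).trace.re = (E₀ * P).trace.re - (E₁ * P).trace.re -
      ((E₀ * Q).trace.re - (E₁ * Q).trace.re) := by
  simp only [sub_mul, mul_sub, trace_sub, Complex.sub_re]

/-- If `p` and `q` are the probabilities of the first outcome, the bias is `2 (p - q)`, which
accounts for the factor `1 / 4`. -/
theorem fidelity_le_sqrt_of_measurement {P Q E₀ E₁ : Matrix n n ℂ} (hP : P.PosSemidef)
    (hQ : Q.PosSemidef) (hP1 : P.trace = 1) (hQ1 : Q.trace = 1) (h₀ : E₀.PosSemidef)
    (h₁ : E₁.PosSemidef) (h : E₀ + E₁ = 1) :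
    fidelity P Q ≤ Real.sqrt (1 - 1 / 4 * ((E₀ - E₁) * (P - Q)).trace.re ^ 2) := by
  refine (fidelity_le_sqrt_add_sqrt hP hQ h₀ h₁ h).trans ?_
  have hp := re_trace_mul_add_of_add_eq_one hP1 h
  have hq := re_trace_mul_add_of_add_eq_one hQ1 h
  have p0 := re_trace_mul_nonneg h₀ hP
  have p1 := re_trace_mul_nonneg h₁ hP
  have q0 := re_trace_mul_nonneg h₀ hQ
  have q1 := re_trace_mul_nonneg h₁ hQ
  rw [re_trace_sub_mul_sub, eq_sub_of_add_eq' hp, eq_sub_of_add_eq' hq]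
  refine (sqrt_mul_add_sqrt_mul_le p0 (by linarith) q0 (by linarith)).trans_eq ?_
  congr 1
  ring

theorem statesPerfectlyDistinguishable_iff {P Q : Matrix n n ℂ} (hP : P.PosSemidef)
    (hQ : Q.PosSemidef) (hP1 : P.trace = 1) (hQ1 : Q.trace = 1) :
    StatesPerfectlyDistinguishable P Q ↔ fidelity P Q = 0 := by
  constructor
  · rintro ⟨E₀, E₁, h₀, h₁, h, hp, hq⟩
    have hp' := re_trace_mul_add_of_add_eq_one hP1 h
    have hq' := re_trace_mul_add_of_add_eq_one hQ1 h
    rw [hp, Complex.one_re] at hp'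
    rw [hq, Complex.one_re] at hq'
    have hF := fidelity_le_sqrt_add_sqrt hP hQ h₀ h₁ h
    rw [show (E₀ * Q).trace.re = 0 by linarith, show (E₁ * P).trace.re = 0 by linarith] at hF
    exact le_antisymm (by simpa using hF) (traceNorm_nonneg _)
  · intro hF
    obtain ⟨E₀, E₁, h₀, h₁, h, hv⟩ := exists_measurement_ge hP hQ
    have hp := re_trace_mul_add_of_add_eq_one hP1 h
    have hq := re_trace_mul_add_of_add_eq_one hQ1 h
    have p1 := re_trace_mul_nonneg h₁ hP
    have q0 := re_trace_mul_nonneg h₀ hQ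
    rw [hF, hP1, hQ1, re_trace_sub_mul_sub, Complex.one_re] at hv
    refine ⟨E₀, E₁, h₀, h₁, h, Complex.ext ?_ ?_, Complex.ext ?_ ?_⟩
    · rw [Complex.one_re]; linarith
    · exact (Complex.le_def.1 (PosSemidef.trace_mul_nonneg h₀ hP)).2.symm
    · rw [Complex.one_re]; linarith
    · exact (Complex.le_def.1 (PosSemidef.trace_mul_nonneg h₁ hQ)).2.symm

end Measurements

/-! ### The properties of the strategy fidelity. -/

section StrategyFidelity

open Matrix

variable {r : ℕ} {X : Fin (r + 1) → Type*} {Y : Fin r → Type*}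
  [∀ k, Fintype (X k)] [∀ k, DecidableEq (X k)] [Unique (X (Fin.last r))]
  [∀ k, Fintype (Y k)] [∀ k, DecidableEq (Y k)]
  [∀ k, Nonempty (X k)] [∀ k, Nonempty (Y k)]

/-- The reduced final state of the memory of `B` after an interaction with a strategy `S`. -/
def PureCoStrategy.mix (B : PureCoStrategy X Y) (S : Op X Y) :
    Matrix (Fin (B.mem (Fin.last r))) (Fin (B.mem (Fin.last r))) ℂ :=
  B.runMatrix * S * B.runMatrixᴴ

theorem IsStrategy.posSemidef {S : Op X Y} (hS : IsStrategy S) : S.PosSemidef := by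
  obtain ⟨A, rfl⟩ := hS
  rw [A.strategy_eq]
  exact posSemidef_self_mul_conjTranspose _

theorem IsStrategy.mix_posSemidef {S : Op X Y} (hS : IsStrategy S) (B : PureCoStrategy X Y) :
    (B.mix S).PosSemidef :=
  hS.posSemidef.mul_mul_conjTranspose_same _

theorem IsStrategy.trace_mix {S : Op X Y} (hS : IsStrategy S) (B : PureCoStrategy X Y) :
    (B.mix S).trace = 1 := by
  obtain ⟨A, rfl⟩ := hS
  rw [PureCoStrategy.mix, ← finalMix_eq, trace_finalMix]

theorem mem_fidelityValues_iff {S T : Op X Y} (hS : IsStrategy S) (hT : IsStrategy T) {f : ℝ} :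
    f ∈ fidelityValues S T ↔ ∃ B : PureCoStrategy X Y, f = fidelity (B.mix S) (B.mix T) := by
  constructor
  · rintro ⟨A, A', rfl, rfl, B, rfl⟩
    exact ⟨B, by rw [finalMix_eq, finalMix_eq]; rfl⟩
  · rintro ⟨B, rfl⟩
    obtain ⟨A, rfl⟩ := hS
    obtain ⟨A', rfl⟩ := hT
    exact ⟨A, A', rfl, rfl, B, by rw [finalMix_eq, finalMix_eq]; rfl⟩

theorem perfectlyDistinguishable_iff {S T : Op X Y} (hS : IsStrategy S) (hT : IsStrategy T) :
    PerfectlyDistinguishable S T ↔ 0 ∈ fidelityValues S T := by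
  rw [mem_fidelityValues_iff hS hT]
  have h : ∀ B : PureCoStrategy X Y, StatesPerfectlyDistinguishable (B.mix S) (B.mix T) ↔
      0 = fidelity (B.mix S) (B.mix T) := fun B =>
    (statesPerfectlyDistinguishable_iff (hS.mix_posSemidef B) (hT.mix_posSemidef B)
      (hS.trace_mix B) (hT.trace_mix B)).trans eq_comm
  simp only [← h]
  constructor
  · rintro ⟨A, A', rfl, rfl, B, hB⟩
    exact ⟨B, by rwa [finalMix_eq, finalMix_eq] at hB⟩
  · rintro ⟨B, hB⟩
    obtain ⟨A, rfl⟩ := hS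
    obtain ⟨A', rfl⟩ := hT
    exact ⟨A, A', rfl, rfl, B, by rwa [finalMix_eq, finalMix_eq]⟩

/-- The pure co-strategy enters only through its operator, so minimizing over `B` is minimizing a
continuous function on a compact set. -/
theorem PureCoStrategy.fidelity_mix (B : PureCoStrategy X Y) {S T : Op X Y}
    (hS : S.PosSemidef) (hT : T.PosSemidef) :
    fidelity (B.mix S) (B.mix T) = traceNorm (CFC.sqrt S * B.coStrategy * CFC.sqrt T) := by
  have h : ∀ {S : Op X Y}, S.PosSemidef →
      B.mix S = (B.runMatrix * CFC.sqrt S) * (B.runMatrix * CFC.sqrt S)ᴴ := fun {S} hS => by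
    rw [conjTranspose_mul, conjTranspose_sqrt, Matrix.mul_assoc, ← Matrix.mul_assoc (CFC.sqrt S),
      sqrt_mul_sqrt hS, mix, Matrix.mul_assoc]
  rw [h hS, h hT, fidelity_mul_conjTranspose, B.coStrategy_eq, conjTranspose_mul,
    conjTranspose_sqrt]
  simp only [Matrix.mul_assoc]

theorem isLeast_strategyFidelity {S T : Op X Y} (hS : IsStrategy S) (hT : IsStrategy T) :
    IsLeast (fidelityValues S T) (strategyFidelity S T) := by
  have e : fidelityValues S T = (fun C => traceNorm (CFC.sqrt S * C * CFC.sqrt T)) ''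
      {C : Op X Y | IsCoStrategy C} := by
    ext f
    rw [mem_fidelityValues_iff hS hT]
    constructor
    · rintro ⟨B, rfl⟩
      exact ⟨B.coStrategy, ⟨B, rfl⟩, (B.fidelity_mix hS.posSemidef hT.posSemidef).symm⟩
    · rintro ⟨_, ⟨B, rfl⟩, rfl⟩
      exact ⟨B, (B.fidelity_mix hS.posSemidef hT.posSemidef).symm⟩
  have hc : IsCompact (fidelityValues S T) := by
    rw [e]
    exact isCompact_isCoStrategy.image (continuous_traceNorm.comp (by fun_prop))
  obtain ⟨c, -, hc1⟩ := exists_isCoStrategy_smul_one (X := X) (Y := Y)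
  have hne : (fidelityValues S T).Nonempty := by
    rw [e]
    exact ⟨_, _, hc1, rfl⟩
  exact hc.isLeast_sInf hne

theorem IsCoStrategy.diag_le_one {C : Op X Y} (hC : IsCoStrategy C)
    (p : OutIdx Y × InIdx X) : C p p ≤ 1 := by
  obtain ⟨R, hR, rfl⟩ := isCoStrategy_iff.1 hC
  exact hR.diag_le_one _ _

theorem isGreatest_strategyNorm (H : Op X Y) : IsGreatest (normValues H) (strategyNorm H) := by
  let K : Set (Op X Y × Op X Y) :=
    {B | B.1.PosSemidef ∧ B.2.PosSemidef ∧ IsCoStrategy (B.1 + B.2)}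
  have e : normValues H = (fun B : Op X Y × Op X Y => ((B.1 - B.2)ᴴ * H).trace.re) '' K := by
    ext v
    constructor
    · rintro ⟨B₀, B₁, h₀, h₁, h, rfl⟩
      exact ⟨(B₀, B₁), ⟨h₀, h₁, h⟩, rfl⟩
    · rintro ⟨B, ⟨h₀, h₁, h⟩, rfl⟩
      exact ⟨B.1, B.2, h₀, h₁, h, rfl⟩
  let L : Set (Op X Y) := {M | ∀ p q, M p q ∈ Metric.closedBall (0 : ℂ) 1}
  have hL : IsCompact L := by
    have h := isCompact_univ_pi fun _ : OutIdx Y × InIdx X =>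
      isCompact_univ_pi fun _ : OutIdx Y × InIdx X => isCompact_closedBall (0 : ℂ) 1
    have e : L = Set.univ.pi fun _ : OutIdx Y × InIdx X =>
        Set.univ.pi fun _ : OutIdx Y × InIdx X => Metric.closedBall (0 : ℂ) 1 := by
      ext M
      exact ⟨fun h p _ q _ => h p q, fun h p q => h p trivial q trivial⟩
    rw [e]
    exact h
  -- Both positive summands have diagonals below that of a co-strategy, hence entries of modulus at
  -- most one.
  have hK : IsCompact K := by
    refine (hL.prod hL).of_isClosed_subset ?_ fun B hB => ?_
    · exact (isClosed_posSemidef.preimage continuous_fst).inter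
        ((isClosed_posSemidef.preimage continuous_snd).inter
          (isCompact_isCoStrategy.isClosed.preimage (continuous_fst.add continuous_snd)))
    · have hd := fun p => hB.2.2.diag_le_one p
      refine ⟨fun p q => ?_, fun p q => ?_⟩ <;> rw [mem_closedBall_zero_iff]
      · exact norm_apply_le_one_of_diag_le_one hB.1
          (fun i => (le_add_of_nonneg_right hB.2.1.diag_nonneg).trans (hd i)) p q
      · exact norm_apply_le_one_of_diag_le_one hB.2.1
          (fun i => (le_add_of_nonneg_left hB.1.diag_nonneg).trans (hd i)) p q
  have hc : IsCompact (normValues H) := by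
    rw [e]
    refine hK.image (Complex.continuous_re.comp ?_)
    fun_prop
  obtain ⟨c, hc0, hc1⟩ := exists_isCoStrategy_smul_one (X := X) (Y := Y)
  have hne : (normValues H).Nonempty :=
    ⟨_, _, 0, PosSemidef.one.smul (show (0 : ℂ) ≤ c by simpa using hc0.le), .zero,
      by rwa [add_zero], rfl⟩
  exact hc.isGreatest_sSup hne

/-- Splitting a co-strategy into two positive parts amounts to measuring the final memory, so the
norm is a maximal measurement bias. -/
theorem mem_normValues_iff {H : Op X Y} {v : ℝ} :
    v ∈ normValues H ↔ ∃ (B : PureCoStrategy X Y)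
      (E₀ E₁ : Matrix (Fin (B.mem (Fin.last r))) (Fin (B.mem (Fin.last r))) ℂ),
      E₀.PosSemidef ∧ E₁.PosSemidef ∧ E₀ + E₁ = 1 ∧
        v = ((E₀ - E₁) * B.mix H).trace.re := by
  have key : ∀ (B : PureCoStrategy X Y) 
      {E₀ E₁ : Matrix (Fin (B.mem (Fin.last r))) (Fin (B.mem (Fin.last r))) ℂ}, E₀.PosSemidef → E₁.PosSemidef →
      ((B.runMatrixᴴ * E₀ * B.runMatrix - B.runMatrixᴴ * E₁ * B.runMatrix)ᴴ * H).trace =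
        ((E₀ - E₁) * B.mix H).trace := fun B E₀ E₁ h₀ h₁ => by
    rw [← Matrix.sub_mul, ← Matrix.mul_sub, conjTranspose_mul, conjTranspose_mul,
      conjTranspose_conjTranspose, (h₀.1.sub h₁.1).eq, Matrix.mul_assoc, trace_mul_comm,
      Matrix.mul_assoc, Matrix.mul_assoc, PureCoStrategy.mix, Matrix.mul_assoc]
  constructor
  · rintro ⟨B₀, B₁, h₀, h₁, ⟨B, hB⟩, rfl⟩
    rw [B.coStrategy_eq] at hB
    obtain ⟨E₀, E₁, hE₀, hE₁, hE, rfl, rfl⟩ := exists_measurement_of_add_eq h₀ h₁ hB.symm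
    exact ⟨B, E₀, E₁, hE₀, hE₁, hE, by rw [key B hE₀ hE₁]⟩
  · rintro ⟨B, E₀, E₁, hE₀, hE₁, hE, rfl⟩
    refine ⟨_, _, hE₀.conjTranspose_mul_mul_same B.runMatrix,
      hE₁.conjTranspose_mul_mul_same B.runMatrix, ⟨B, ?_⟩, by rw [key B hE₀ hE₁]⟩
    rw [← Matrix.add_mul, ← Matrix.mul_add, hE, Matrix.mul_one, B.coStrategy_eq]

theorem PureCoStrategy.mix_sub (B : PureCoStrategy X Y) (S T : Op X Y) :
    B.mix (S - T) = B.mix S - B.mix T := by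
  rw [mix, Matrix.mul_sub, Matrix.sub_mul]
  rfl

/-- At a co-strategy minimizing the fidelity, the measurement of `exists_measurement_ge` gives a
candidate for the norm. The upper bound conversely starts from an optimizer of the norm. -/
theorem one_sub_strategyNorm_le {S T : Op X Y} (hS : IsStrategy S) (hT : IsStrategy T) :
    1 - 1 / 2 * strategyNorm (S - T) ≤ strategyFidelity S T := by
  obtain ⟨B, hB⟩ := (mem_fidelityValues_iff hS hT).1 (isLeast_strategyFidelity hS hT).1
  obtain ⟨E₀, E₁, h₀, h₁, h, hv⟩ := exists_measurement_ge (hS.mix_posSemidef B)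
    (hT.mix_posSemidef B)
  have hn := (isGreatest_strategyNorm (S - T)).2 (mem_normValues_iff.2 ⟨B, E₀, E₁, h₀, h₁, h, rfl⟩)
  rw [B.mix_sub] at hn
  rw [hS.trace_mix, hT.trace_mix, Complex.one_re, ← hB] at hv
  linarith

theorem strategyFidelity_le_sqrt {S T : Op X Y} (hS : IsStrategy S) (hT : IsStrategy T) :
    strategyFidelity S T ≤ Real.sqrt (1 - 1 / 4 * strategyNorm (S - T) ^ 2) := by
  obtain ⟨B, E₀, E₁, h₀, h₁, h, hv⟩ := mem_normValues_iff.1 (isGreatest_strategyNorm (S - T)).1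
  rw [hv, B.mix_sub]
  exact ((isLeast_strategyFidelity hS hT).2 ((mem_fidelityValues_iff hS hT).2 ⟨B, rfl⟩)).trans
    (fidelity_le_sqrt_of_measurement (hS.mix_posSemidef B) (hT.mix_posSemidef B)
      (hS.trace_mix B) (hT.trace_mix B) h₀ h₁ h)

theorem strategyFidelity_comm {S T : Op X Y} (hS : IsStrategy S) (hT : IsStrategy T) :
    strategyFidelity S T = strategyFidelity T S := by
  rw [strategyFidelity, strategyFidelity]
  congr 1
  ext f
  rw [mem_fidelityValues_iff hS hT, mem_fidelityValues_iff hT hS]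
  simp only [fidelity_comm]

theorem strategyFidelity_nonneg {S T : Op X Y} (hS : IsStrategy S) (hT : IsStrategy T) :
    0 ≤ strategyFidelity S T := by
  obtain ⟨B, hB⟩ := (mem_fidelityValues_iff hS hT).1 (isLeast_strategyFidelity hS hT).1
  rw [hB]
  exact traceNorm_nonneg _

theorem strategyFidelity_le_one {S T : Op X Y} (hS : IsStrategy S) (hT : IsStrategy T) :
    strategyFidelity S T ≤ 1 := by
  refine (strategyFidelity_le_sqrt hS hT).trans (Real.sqrt_le_one.2 ?_)
  linarith [sq_nonneg (strategyNorm (S - T))]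

/-- Splitting the co-strategy `c • 1` along the spectral projections of `H` gives the value `c
‖H‖₁`. -/
theorem eq_zero_of_strategyNorm_le_zero {H : Op X Y} (hH : H.IsHermitian)
    (h : strategyNorm H ≤ 0) : H = 0 := by
  obtain ⟨E₀, E₁, N₀, N₁, h₀, h₁, hE, hN₀, hN₁, hD, hl, -⟩ := exists_sign_decomposition hH
  obtain ⟨c, hc0, hc1⟩ := exists_isCoStrategy_smul_one (X := X) (Y := Y)
  have hc : (0 : ℂ) ≤ c := by simpa using hc0.le
  have hv := (isGreatest_strategyNorm H).2 ⟨_, _, h₀.smul hc, h₁.smul hc, by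
    rwa [← smul_add, hE], rfl⟩
  rw [← smul_sub, conjTranspose_smul, (h₀.1.sub h₁.1).eq, Matrix.smul_mul, hl, trace_smul,
    RCLike.star_def, Complex.conj_ofReal, smul_eq_mul, Complex.re_ofReal_mul] at hv
  have hN := hN₀.add hN₁
  have ht := Complex.le_def.1 hN.trace_nonneg
  have ht0 : (N₀ + N₁).trace.re ≤ 0 := by
    by_contra hpos
    have := mul_pos hc0 (not_le.1 hpos)
    linarith
  have ht1 : (N₀ + N₁).trace = 0 := Complex.ext (le_antisymm ht0 ht.1) ht.2.symm
  rw [trace_add] at ht1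
  have n0 := hN₀.trace_nonneg
  have n1 := hN₁.trace_nonneg
  have hz := (add_eq_zero_iff_of_nonneg n0 n1).1 ht1
  rw [hD, hN₀.trace_eq_zero_iff.1 hz.1, hN₁.trace_eq_zero_iff.1 hz.2, sub_zero]

theorem strategyFidelity_eq_one_iff {S T : Op X Y} (hS : IsStrategy S) (hT : IsStrategy T) :
    strategyFidelity S T = 1 ↔ S = T := by
  constructor
  · intro h
    have h1 := strategyFidelity_le_sqrt hS hT
    rw [h, Real.one_le_sqrt] at h1
    have h2 : strategyNorm (S - T) = 0 := by
      rw [← sq_eq_zero_iff]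
      exact le_antisymm (by linarith) (sq_nonneg _)
    exact sub_eq_zero.1 (eq_zero_of_strategyNorm_le_zero
      (hS.posSemidef.1.sub hT.posSemidef.1) h2.le)
  · rintro rfl
    have h1 : strategyNorm (S - S) = 0 := by
      obtain ⟨B₀, B₁, -, -, -, h⟩ := (isGreatest_strategyNorm (S - S)).1
      rw [h, sub_self, Matrix.mul_zero, trace_zero, Complex.zero_re]
    have h2 := one_sub_strategyNorm_le hS hS
    rw [h1] at h2
    exact le_antisymm (strategyFidelity_le_one hS hS) (by linarith)

theorem strategyFidelity_eq_zero_iff {S T : Op X Y} (hS : IsStrategy S) (hT : IsStrategy T) :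
    strategyFidelity S T = 0 ↔ PerfectlyDistinguishable S T := by
  rw [perfectlyDistinguishable_iff hS hT]
  have hl := isLeast_strategyFidelity hS hT
  exact ⟨fun h => h ▸ hl.1, fun h => le_antisymm (hl.2 h) (strategyFidelity_nonneg hS hT)⟩

theorem PureCoStrategy.mix_sum {ι : Type*} [Fintype ι] (B : PureCoStrategy X Y)
    (S : ι → Op X Y) (c : ι → ℝ) :
    B.mix (∑ i, (c i : ℂ) • S i) = ∑ i, (c i : ℂ) • B.mix (S i) := by
  simp only [mix, Matrix.mul_sum, Matrix.sum_mul, Matrix.mul_smul, Matrix.smul_mul]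

/-- An optimal co-strategy for the mixtures is a candidate for every pair; joint concavity for
states does the rest. -/
theorem sum_strategyFidelity_le {ι : Type*} [Fintype ι] [DecidableEq ι] {S T : ι → Op X Y}
    {c : ι → ℝ} (hS : ∀ i, IsStrategy (S i)) (hT : ∀ i, IsStrategy (T i)) (hc : ∀ i, 0 ≤ c i)
    (hc1 : ∑ i, c i = 1) :
    ∑ i, c i * strategyFidelity (S i) (T i) ≤
      strategyFidelity (∑ i, (c i : ℂ) • S i) (∑ i, (c i : ℂ) • T i) := by
  have hS' := IsStrategy.convexCombination hS hc hc1
  have hT' := IsStrategy.convexCombination hT hc hc1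
  obtain ⟨B, hB⟩ := (mem_fidelityValues_iff hS' hT').1 (isLeast_strategyFidelity hS' hT').1
  rw [hB, B.mix_sum, B.mix_sum]
  refine le_trans (Finset.sum_le_sum fun i _ => mul_le_mul_of_nonneg_left ?_ (hc i))
    (sum_fidelity_le _ _ c (fun i => (hS i).mix_posSemidef B) (fun i => (hT i).mix_posSemidef B) hc)
  exact (isLeast_strategyFidelity (hS i) (hT i)).2
    ((mem_fidelityValues_iff (hS i) (hT i)).2 ⟨B, rfl⟩)

end StrategyFidelity
end QuantumStrategy
theorem mainTheorem4 {r : ℕ} (hr : 1 ≤ r)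
    (X : Fin (r + 1) → Type*) (Y : Fin r → Type*)
    [∀ k, Fintype (X k)] [∀ k, DecidableEq (X k)] [∀ k, Nonempty (X k)]
    [Unique (X (Fin.last r))]
    [∀ k, Fintype (Y k)] [∀ k, DecidableEq (Y k)] [∀ k, Nonempty (Y k)] :
    (∀ S T : QuantumStrategy.Op X Y,
      QuantumStrategy.IsStrategy S → QuantumStrategy.IsStrategy T →
        -- the minimum and the maximum in the definitions are attained
        (IsLeast (QuantumStrategy.fidelityValues S T) (QuantumStrategy.strategyFidelity S T) ∧
          IsGreatest (QuantumStrategy.normValues (S - T)) (QuantumStrategy.strategyNorm (S - T))) ∧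
        -- Fuchs–van de Graaf inequalities
        (1 - 1 / 2 * QuantumStrategy.strategyNorm (S - T) ≤ QuantumStrategy.strategyFidelity S T ∧
          QuantumStrategy.strategyFidelity S T ≤
            Real.sqrt (1 - 1 / 4 * QuantumStrategy.strategyNorm (S - T) ^ 2)) ∧
        -- symmetry
        QuantumStrategy.strategyFidelity S T = QuantumStrategy.strategyFidelity T S ∧
        -- bounds
        (0 ≤ QuantumStrategy.strategyFidelity S T ∧ QuantumStrategy.strategyFidelity S T ≤ 1) ∧
        (QuantumStrategy.strategyFidelity S T = 1 ↔ S = T) ∧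
        (QuantumStrategy.strategyFidelity S T = 0 ↔
          QuantumStrategy.PerfectlyDistinguishable S T)) ∧
    -- joint concavity
    (∀ (n : ℕ) (S T : Fin n → QuantumStrategy.Op X Y) (c : Fin n → ℝ),
      (∀ i, QuantumStrategy.IsStrategy (S i)) → (∀ i, QuantumStrategy.IsStrategy (T i)) →
      (∀ i, 0 ≤ c i) → ∑ i, c i = 1 →
        QuantumStrategy.IsStrategy (∑ i, (c i : ℂ) • S i) ∧
        QuantumStrategy.IsStrategy (∑ i, (c i : ℂ) • T i) ∧
        ∑ i, c i * QuantumStrategy.strategyFidelity (S i) (T i) ≤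
          QuantumStrategy.strategyFidelity (∑ i, (c i : ℂ) • S i) (∑ i, (c i : ℂ) • T i)) := by
  open QuantumStrategy in
  exact ⟨fun S T hS hT =>
    ⟨⟨isLeast_strategyFidelity hS hT, isGreatest_strategyNorm (S - T)⟩,
      ⟨one_sub_strategyNorm_le hS hT, strategyFidelity_le_sqrt hS hT⟩,
      strategyFidelity_comm hS hT,
      ⟨strategyFidelity_nonneg hS hT, strategyFidelity_le_one hS hT⟩,
      strategyFidelity_eq_one_iff hS hT, strategyFidelity_eq_zero_iff hS hT⟩,
    fun _ _ _ _ hS hT hc hc1 =>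
      ⟨IsStrategy.convexCombination hS hc hc1, IsStrategy.convexCombination hT hc hc1,
        sum_strategyFidelity_le hS hT hc hc1⟩⟩
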